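/- Let $p\in(0,1)$, $q=1-p$, and let $\Xi^{(1)},\Xi^{(2)},\dots$ be i.i.d. random infinite strings whose letters are i.i.d. with values in $\{0,1\}$, equal to $1$ with probability $p$ and to $0$ with probability $q$. The trie of a finite set of strings is the binary tree constructed recursively as follows: no string gives the empty tree; one string gives a single node, which stores it; two or more strings give a root, from which the strings whose first letter is $0$ (respectively $1$) are passed to the left (respectively right) subtree, constructed by the same rule using the next letter, and so on. The Patricia trie is obtained from the trie by eliminating all internal nodes with only one child. Let $D_n$ and $D_n^P$ be the depths (path lengths from the root) of the node storing $\Xi^{(1)}$ in the trie and in the Patricia trie, respectively, of $\Xi^{(1)},\dots,\Xi^{(n)}$. Put $H=-p\ln p-q\ln q$ and $H_2=p\ln^2p+q\ln^2q$, and let $\gamma$ be Euler's constant. Then all $D_n$ and $D_n^P$ have finite expectation, and the following hold. (i) If $\ln p/\ln q$ is irrational, then, as $n\to\infty$, $$\mathbb E D_n^P=\frac{\ln n}{H}+\frac{H_2}{2H^2}+\frac{\gamma+q\ln p+p\ln q}{H}+o(1).$$ (ii) If $\ln p/\ln q$ is rational, let $d$ be the largest positive real number such that $\ln p$ and $\ln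 q$ are both integer multiples of $d$. Then the series $$\psi(t)=-\frac1H\sum_{k\in\mathbb Z,\,k\neq0}\Gamma(-2\pi\mathrm i k/d)\,e^{2\pi\mathrm i kt/d}$$ converges absolutely for every real $t$ and defines a continuous real-valued function with period $d$, and, as $n\to\infty$, $$\mathbb E D_n=\frac{\ln n}{H}+\frac{H_2}{2H^2}+\frac{\gamma}{H}+\psi(\ln n)+o(1),$$ $$\mathbb E D_n^P=\frac{\ln n}{H}+\frac{H_2}{2H^2}+\frac{\gamma+q\ln p+p\ln q}{H}+\psi(\ln n)+o(1).$$ That is, the oscillating term for the Patricia trie is the same as for the ordinary trie. (iii) For every $p\in(0,1)$, whether $\ln p/\ln q$ is rational or not, the expected saving in depth converges, without oscillation: $$\mathbb E(D_n-D_n^P)\to\frac{-q\ln p-p\ln q}{H}\qquad\text{as } n\to\infty.$$ -/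

import Mathlib

open MeasureTheory ProbabilityTheory Filter Topology

noncomputable section

namespace RandomTrie

/-- Infinite strings over the alphabet `{0, 1}`: `true` is the letter `1`, `false` the letter `0`.
The first letter has position `0`. -/
abbrev BitString : Type := ℕ → Bool

/-- Finite binary trees whose external nodes (leaves) each store a string; internal nodes store
nothing, and `empty` stands for a missing subtree. -/
inductive BinTree : Type
  | empty : BinTree
  | leaf (s : BitString) : BinTree
  | node (l r : BinTree) : BinTree

namespace BinTree

/-- The string `s` is stored in some leaf of the tree. -/
def Stores (s : BitString) : BinTree → Prop
  | empty => False
  | leaf t => t = s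
  | node l r => Stores s l ∨ Stores s r

open Classical in
/-- The depth (path length from the root) of the leaf in which `s` is stored. It is meaningful
only for a string that is stored in the tree. -/
def depth (s : BitString) : BinTree → ℕ
  | empty => 0
  | leaf _ => 0
  | node l r => (if Stores s l then depth s l else depth s r) + 1

/-- A root above the subtrees `l` and `r`, the root being left out if it would have fewer than
two children. -/
def join : BinTree → BinTree → BinTree
  | empty, r => r
  | l, empty => l
  | l, r => node l r

/-- The compressed tree: all internal nodes with only one child are eliminated. -/
def compress : BinTree → BinTree
  | empty => empty
  | leaf s => leaf s
  | node l r => join (compress l) (compress r)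

end BinTree

open Classical in
/-- The recursive construction of the trie of a finite set `S` of strings, started at letter
position `k`: no string gives the empty trie, one string gives a single node storing it, and two
or more strings give a root, the strings with letter `0` at position `k` being passed to the left
subtree and those with letter `1` to the right one. The first argument bounds the number of
levels of the recursion; the value no longer depends on it once the strings of `S` are pairwise
distinguished by that many letters from position `k` on. -/
def buildTrie : ℕ → ℕ → Finset BitString → BinTree
  | 0, _, S => if h : ∃ s, S = {s} then BinTree.leaf h.choose else BinTree.empty
  | m + 1, k, S =>
      if S = ∅ then BinTree.empty
      else if h : ∃ s, S = {s} then BinTree.leaf h.choose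
      else BinTree.node
        (buildTrie m (k + 1) (S.filter fun s => s k = false))
        (buildTrie m (k + 1) (S.filter fun s => s k = true))

/-- The least `L` such that distinct strings of `S` have distinct prefixes of length `L`
(such an `L` exists for every finite set `S`). -/
def separationLevel (S : Finset BitString) : ℕ :=
  sInf {L : ℕ | ∀ s ∈ S, ∀ t ∈ S, (∀ i < L, s i = t i) → s = t}

/-- The trie of a finite set of strings. -/
def trie (S : Finset BitString) : BinTree :=
  buildTrie (separationLevel S) 0 S

/-- The Patricia trie of a finite set of strings. -/
def patriciaTrie (S : Finset BitString) : BinTree :=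
  (trie S).compress

open Classical in
/-- The set consisting of the first `n` strings of a sequence of strings. -/
def firstStrings (x : ℕ → BitString) (n : ℕ) : Finset BitString :=
  (Finset.range n).image x

/-- The depth `D_n` of the first string in the trie of the first `n` strings. -/
def trieDepth (x : ℕ → BitString) (n : ℕ) : ℕ :=
  (trie (firstStrings x n)).depth (x 0)

/-- The depth `D_n^P` of the first string in the Patricia trie of the first `n` strings. -/
def patriciaDepth (x : ℕ → BitString) (n : ℕ) : ℕ :=
  (patriciaTrie (firstStrings x n)).depth (x 0)

/-- The second moment `H₂ = p ln² p + q ln² q` of `-ln P(ξ)` for a letter `ξ`. -/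
def entropySecondMoment (p q : ℝ) : ℝ :=
  p * Real.log p ^ 2 + q * Real.log q ^ 2

/-- The positive reals of which both `x` and `y` are integer multiples; `gcd(x, y)` is the
greatest of them. -/
def commonDivisors (x y : ℝ) : Set ℝ :=
  {d : ℝ | 0 < d ∧ (∃ m : ℤ, x = m * d) ∧ ∃ m : ℤ, y = m * d}

end RandomTrie

end

/-! Write `n = N + 1`, let `P(w)` be the probability of a word, `φ(t) = 1 - exp(-exp t)`, and
`(TG)(t) = p G(t + ln p) + q G(t + ln q)`, so that `T^k G(t) = ∑ P(w) G(t + ln P(w))` over words of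
length `k`.

A depth counts levels. Level `k` counts in the trie if another string shares the first `k` letters
of the first string, and in the Patricia trie if, in addition, some such string branches off there.
Hence `E D_n = ∑_w P(w) (1 - (1 - P(w))^N)`. With `R_c = ∑_w P(w) (1 - (1 - c P(w))^N)`, the
Patricia depth has mean `p R_q + q R_p`. Replacing `(1 - y)^N` by `exp(-n y)` costs `O(1/n)` after
summation (`exists_hasSum_words`), so `R_c = U(ln n + ln c) + O(1/n)` with `U = ∑_k T^k φ`.

Let `Q` be the primitive of `φ` vanishing at `-∞`; it is `t + γ + o(1)` because `Γ'(1) = -γ`. Then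
`g = φ - (Q - TQ)/H` decays exponentially on both sides, and telescoping gives `U = Q/H + V` with `V
= ∑_k T^k g`. This `V` is bounded and solves the renewal equation `V = g + TV`.

The key fact is that `ln p` and `ln q` are asymptotic periods of `V`: `V(t) - V(t + u) → 0` for each
`u` in the group they generate (`closure_le_asymptoticPeriods`). A shift of `U` by such a `u`
therefore contributes only `u/H`, from `Q`. So the two mean depths differ asymptotically by the
constant `(p ln q + q ln p)/H`, whatever the arithmetic nature of `ln p / ln q`.

It remains to describe `V`. If the group is dense, all shifts of `V` are asymptotically equal, and
integrating the renewal equation over `(-∞, t]` gives `V → ∫ g / H = H₂/(2H²)`. If the group is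
`dℤ`, summing the equation along `t - jd` gives `V(t) - (d/H) ∑_j g(t + jd) → 0`. Poisson summation
expands the lattice sum: its mean is `H₂/(2H²)`, and the other coefficients are values of `-Γ/H`,
because the centering term has zero transform at the frequencies `2πk/d`, `k ≠ 0`. -/

noncomputable section

namespace RandomTrie

/-! ### Depths as counts of prefix levels -/

/-- Distinct strings of `S` differ at one of the `m` positions from `k` on. -/
def SeparatedWithin (m k : ℕ) (S : Finset BitString) : Prop :=
  ∀ s ∈ S, ∀ t ∈ S, (∀ i < m, s (k + i) = t (k + i)) → s = t

lemma SeparatedWithin.filter {m k : ℕ} {S : Finset BitString} (h : SeparatedWithin (m + 1) k S)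
    (b : Bool) : SeparatedWithin m (k + 1) (S.filter fun s => s k = b) := by
  intro s hs t ht hst
  rw [Finset.mem_filter] at hs ht
  refine h s hs.1 t ht.1 fun i hi => ?_
  rcases i with _ | i
  · simp [hs.2, ht.2]
  · have := hst i (by omega)
    rwa [show k + (i + 1) = k + 1 + i by ring]

lemma SeparatedWithin.eq_empty_or_singleton {k : ℕ} {S : Finset BitString}
    (h : SeparatedWithin 0 k S) : S = ∅ ∨ ∃ s, S = {s} := by
  rcases S.eq_empty_or_nonempty with h0 | ⟨s, hs⟩
  · exact Or.inl h0
  · refine Or.inr ⟨s, Finset.eq_singleton_iff_unique_mem.2 ⟨hs, fun t ht => h t ht s hs ?_⟩⟩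
    simp

lemma buildTrie_empty (m k : ℕ) : buildTrie m k ∅ = BinTree.empty := by
  rcases m with _ | m
  · have : ¬ ∃ s : BitString, (∅ : Finset BitString) = {s} := by
      rintro ⟨s, hs⟩; exact (Finset.singleton_ne_empty s) hs.symm
    simp [buildTrie]
  · simp [buildTrie]

lemma buildTrie_singleton (m k : ℕ) (s : BitString) :
    buildTrie m k {s} = BinTree.leaf s := by
  have h : ∃ t, ({s} : Finset BitString) = {t} := ⟨s, rfl⟩
  have hs : h.choose = s := (Finset.singleton_injective h.choose_spec).symm
  rcases m with _ | m
  · rw [buildTrie, dif_pos h, hs]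
  · rw [buildTrie, if_neg (Finset.singleton_ne_empty s), dif_pos h, hs]

lemma buildTrie_succ {m k : ℕ} {S : Finset BitString} (h0 : S ≠ ∅) (h1 : ¬ ∃ s, S = {s}) :
    buildTrie (m + 1) k S = BinTree.node
        (buildTrie m (k + 1) (S.filter fun s => s k = false))
        (buildTrie m (k + 1) (S.filter fun s => s k = true)) := by
  rw [buildTrie, if_neg h0, dif_neg h1]

lemma stores_buildTrie {m k : ℕ} {S : Finset BitString} (h : SeparatedWithin m k S)
    (s : BitString) : (buildTrie m k S).Stores s ↔ s ∈ S := by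
  induction m generalizing k S with
  | zero =>
    rcases h.eq_empty_or_singleton with rfl | ⟨t, rfl⟩
    · simp [buildTrie_empty, BinTree.Stores]
    · simp [buildTrie_singleton, BinTree.Stores, eq_comm]
  | succ m ih =>
    by_cases h0 : S = ∅
    · simp [h0, buildTrie_empty, BinTree.Stores]
    by_cases h1 : ∃ s, S = {s}
    · obtain ⟨t, rfl⟩ := h1
      simp [buildTrie_singleton, BinTree.Stores, eq_comm]
    rw [buildTrie_succ h0 h1, BinTree.Stores, ih (h.filter false), ih (h.filter true)]
    rcases hk : s k <;> simp [hk]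

namespace BinTree

lemma stores_join (s : BitString) (l r : BinTree) :
    (join l r).Stores s ↔ l.Stores s ∨ r.Stores s := by
  cases l <;> cases r <;> simp [join, Stores]

lemma stores_compress (s : BitString) (T : BinTree) : T.compress.Stores s ↔ T.Stores s := by
  induction T with
  | empty => simp [compress]
  | leaf t => simp [compress]
  | node l r hl hr => rw [compress, stores_join, hl, hr, Stores]

lemma join_empty_right (l : BinTree) : join l empty = l := by cases l <;> rfl

lemma join_eq_node {l r : BinTree} (hl : l ≠ empty) (hr : r ≠ empty) : join l r = node l r := by
  cases l <;> cases r <;> simp_all [join]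

end BinTree

lemma compress_buildTrie_ne_empty {m k : ℕ} {S : Finset BitString} (h : SeparatedWithin m k S)
    (hS : S.Nonempty) : (buildTrie m k S).compress ≠ BinTree.empty := by
  obtain ⟨s, hs⟩ := hS
  intro he
  have := (BinTree.stores_compress s (buildTrie m k S)).2 ((stores_buildTrie h s).2 hs)
  rw [he] at this
  exact this

-- The ancestor of `s` at level `i` is an internal node exactly when another string shares the first
-- `i` letters. Levels left over in the bound `m` contribute zero, since separation leaves no
-- competitor there.
open Classical in
lemma depth_buildTrie {m k : ℕ} {S : Finset BitString} (h : SeparatedWithin m k S)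
    {s : BitString} (hs : s ∈ S) :
    (buildTrie m k S).depth s = ∑ i ∈ Finset.range m,
      if ∃ t ∈ S, t ≠ s ∧ ∀ j < i, t (k + j) = s (k + j) then 1 else 0 := by
  induction m generalizing k S with
  | zero =>
    rcases h.eq_empty_or_singleton with rfl | ⟨t, rfl⟩
    · simp at hs
    · simp [buildTrie_singleton, BinTree.depth]
  | succ m ih =>
    have h0 : S ≠ ∅ := Finset.ne_empty_of_mem hs
    by_cases h1 : ∃ s, S = {s}
    · obtain ⟨t, rfl⟩ := h1
      obtain rfl := Finset.mem_singleton.1 hs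
      rw [buildTrie_singleton, BinTree.depth, eq_comm]
      refine Finset.sum_eq_zero fun i _ => if_neg ?_
      rintro ⟨t', ht', hne, -⟩
      exact hne (Finset.mem_singleton.1 ht')
    have hex : ∃ t ∈ S, t ≠ s := by
      by_contra! hcon
      exact h1 ⟨s, Finset.eq_singleton_iff_unique_mem.2 ⟨hs, hcon⟩⟩
    have key : ∀ b, s k = b →
        (buildTrie m (k + 1) (S.filter fun s => s k = b)).depth s + 1 =
        ∑ i ∈ Finset.range (m + 1),
          if ∃ t ∈ S, t ≠ s ∧ ∀ j < i, t (k + j) = s (k + j) then 1 else 0 := by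
      intro b hb
      rw [ih (h.filter b) (Finset.mem_filter.2 ⟨hs, hb⟩), Finset.sum_range_succ']
      congr 1
      · refine Finset.sum_congr rfl fun i _ => ?_
        congr 1
        rw [eq_iff_iff]
        constructor
        · rintro ⟨t, ht, hne, hj⟩
          rw [Finset.mem_filter] at ht
          refine ⟨t, ht.1, hne, fun j hji => ?_⟩
          rcases j with _ | j
          · simp [ht.2, hb]
          · have := hj j (by omega)
            rwa [show k + (j + 1) = k + 1 + j by ring]
        · rintro ⟨t, ht, hne, hj⟩
          refine ⟨t, Finset.mem_filter.2 ⟨ht, ?_⟩, hne, fun j hji => ?_⟩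
          · have := hj 0 (by omega)
            simpa [hb] using this
          · have := hj (j + 1) (by omega)
            rwa [show k + 1 + j = k + (j + 1) by ring]
      · rw [if_pos]
        simpa using hex
    rw [buildTrie_succ h0 h1, BinTree.depth]
    rcases hb : s k
    · rw [if_pos ((stores_buildTrie (h.filter false) s).2 (Finset.mem_filter.2 ⟨hs, hb⟩))]
      exact key false hb
    · rw [if_neg (by rw [stores_buildTrie (h.filter false) s]; simp [hb])]
      exact key true hb

-- Compression keeps the ancestor at level `i` exactly when both of its subtrees are nonempty, that
-- is, when some string follows `s` for `i` letters and then takes the other branch.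
open Classical in
lemma depth_compress_buildTrie {m k : ℕ} {S : Finset BitString} (h : SeparatedWithin m k S)
    {s : BitString} (hs : s ∈ S) :
    (buildTrie m k S).compress.depth s = ∑ i ∈ Finset.range m,
      if ∃ t ∈ S, (∀ j < i, t (k + j) = s (k + j)) ∧ t (k + i) ≠ s (k + i) then 1 else 0 := by
  induction m generalizing k S with
  | zero =>
    rcases h.eq_empty_or_singleton with rfl | ⟨t, rfl⟩
    · simp at hs
    · simp [buildTrie_singleton, BinTree.depth, BinTree.compress]
  | succ m ih =>
    have h0 : S ≠ ∅ := Finset.ne_empty_of_mem hs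
    by_cases h1 : ∃ s, S = {s}
    · obtain ⟨t, rfl⟩ := h1
      obtain rfl := Finset.mem_singleton.1 hs
      rw [buildTrie_singleton, BinTree.compress, BinTree.depth, eq_comm]
      refine Finset.sum_eq_zero fun i _ => if_neg ?_
      rintro ⟨t', ht', -, hne⟩
      exact hne (by rw [Finset.mem_singleton.1 ht'])
    have key : ∀ b, s k = b →
        (buildTrie m (k + 1) (S.filter fun s => s k = b)).compress.depth s +
          (if ∃ t ∈ S, t k ≠ s k then 1 else 0) =
        ∑ i ∈ Finset.range (m + 1),
          if ∃ t ∈ S, (∀ j < i, t (k + j) = s (k + j)) ∧ t (k + i) ≠ s (k + i)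
            then 1 else 0 := by
      intro b hb
      rw [ih (h.filter b) (Finset.mem_filter.2 ⟨hs, hb⟩), Finset.sum_range_succ']
      congr 1
      · refine Finset.sum_congr rfl fun i _ => ?_
        congr 1
        rw [eq_iff_iff]
        constructor
        · rintro ⟨t, ht, hj, hne⟩
          rw [Finset.mem_filter] at ht
          refine ⟨t, ht.1, fun j hji => ?_, ?_⟩
          · rcases j with _ | j
            · simp [ht.2, hb]
            · have := hj j (by omega)
              rwa [show k + (j + 1) = k + 1 + j by ring]
          · rwa [show k + (i + 1) = k + 1 + i by ring]
        · rintro ⟨t, ht, hj, hne⟩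
          refine ⟨t, Finset.mem_filter.2 ⟨ht, ?_⟩, fun j hji => ?_, ?_⟩
          · have := hj 0 (by omega)
            simpa [hb] using this
          · have := hj (j + 1) (by omega)
            rwa [show k + 1 + j = k + (j + 1) by ring]
          · rwa [show k + 1 + i = k + (i + 1) by ring]
      · simp
    have stores : ∀ b, (buildTrie m (k + 1) (S.filter fun s => s k = b)).compress.Stores s ↔
        s k = b := fun b => by
      rw [BinTree.stores_compress, stores_buildTrie (h.filter b), Finset.mem_filter]
      simp [hs]
    have nonempty : ∀ b, (∃ t ∈ S, t k = b) →
        (buildTrie m (k + 1) (S.filter fun s => s k = b)).compress ≠ BinTree.empty :=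
      fun b ⟨t, ht, htb⟩ => compress_buildTrie_ne_empty (h.filter b)
        ⟨t, Finset.mem_filter.2 ⟨ht, htb⟩⟩
    have empty : ∀ b, ¬ (∃ t ∈ S, t k = b) →
        (buildTrie m (k + 1) (S.filter fun s => s k = b)).compress = BinTree.empty := by
      intro b hb
      have : (S.filter fun s => s k = b) = ∅ := by
        rw [Finset.filter_eq_empty_iff]
        exact fun t ht htb => hb ⟨t, ht, htb⟩
      rw [this, buildTrie_empty, BinTree.compress]
    rw [buildTrie_succ h0 h1, BinTree.compress]
    rcases hb : s k
    · rw [← key false hb]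
      by_cases hex : ∃ t ∈ S, t k ≠ s k
      · have hex' : ∃ t ∈ S, t k = true := by simpa [hb] using hex
        rw [if_pos hex, BinTree.join_eq_node (nonempty false ⟨s, hs, hb⟩) (nonempty true hex'),
          BinTree.depth, if_pos ((stores false).2 hb)]
      · have hex' : ¬ ∃ t ∈ S, t k = true := by simpa [hb] using hex
        rw [if_neg hex, empty true hex', BinTree.join_empty_right, add_zero]
    · rw [← key true hb]
      by_cases hex : ∃ t ∈ S, t k ≠ s k
      · have hex' : ∃ t ∈ S, t k = false := by simpa [hb] using hex
        rw [if_pos hex, BinTree.join_eq_node (nonempty false hex') (nonempty true ⟨s, hs, hb⟩),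
          BinTree.depth, if_neg (by rw [stores false, hb]; simp)]
      · have hex' : ¬ ∃ t ∈ S, t k = false := by simpa [hb] using hex
        rw [if_neg hex, empty false hex', BinTree.join, add_zero]

lemma separatedWithin_separationLevel (S : Finset BitString) :
    SeparatedWithin (separationLevel S) 0 S := by
  have hne : {L : ℕ | ∀ s ∈ S, ∀ t ∈ S, (∀ i < L, s i = t i) → s = t}.Nonempty := by
    have hex : ∀ s t : BitString, ∃ i, s ≠ t → s i ≠ t i := by
      intro s t
      by_cases h : s = t
      · exact ⟨0, fun h' => absurd h h'⟩
      · obtain ⟨i, hi⟩ := Function.ne_iff.1 h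
        exact ⟨i, fun _ => hi⟩
    choose f hf using hex
    -- One more than the largest of the chosen positions at which two distinct strings differ.
    -- Nonemptiness matters because the infimum of the empty set of naturals is `0`, which need not
    -- separate anything.
    refine ⟨S.sup (fun s => S.sup fun t => f s t) + 1, fun s hs t ht hst => ?_⟩
    by_contra hne
    refine hf s t hne (hst _ (Nat.lt_succ_of_le ?_))
    exact (Finset.le_sup (f := fun t => f s t) ht).trans
      (Finset.le_sup (f := fun s => S.sup fun t => f s t) hs)
  intro s hs t ht hst
  exact Nat.sInf_mem hne s hs t ht (fun i hi => by simpa using hst i hi)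

open Classical in
/-- The depth of the first string in the trie is the number of its proper prefixes shared with
another string. -/
lemma hasSum_trieDepth (x : ℕ → BitString) {n : ℕ} (hn : 0 < n) :
    HasSum (fun k => if ∃ j < n, x j ≠ x 0 ∧ ∀ i < k, x j i = x 0 i then (1 : ℝ) else 0)
      (trieDepth x n) := by
  have hmem : x 0 ∈ firstStrings x n :=
    Finset.mem_image_of_mem x (Finset.mem_range.2 hn)
  have hsep := separatedWithin_separationLevel (firstStrings x n)
  rw [trieDepth, trie, depth_buildTrie hsep hmem, Nat.cast_sum]
  have heq : ∀ k, (if ∃ j < n, x j ≠ x 0 ∧ ∀ i < k, x j i = x 0 i then (1 : ℝ) else 0) =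
      ((if ∃ t ∈ firstStrings x n, t ≠ x 0 ∧ ∀ j < k, t (0 + j) = x 0 (0 + j) then 1 else 0 : ℕ)
        : ℝ) := by
    intro k
    simp [firstStrings]
  simp_rw [heq]
  refine hasSum_sum_of_ne_finset_zero fun k hk => ?_
  rw [Nat.cast_eq_zero]
  refine if_neg ?_
  rintro ⟨t, ht, hne, hj⟩
  refine hne (hsep t ht (x 0) hmem fun i hi => hj i ?_)
  rw [Finset.mem_range] at hk
  omega

open Classical in
/-- The depth of the first string in the Patricia trie is the number of its proper prefixes after
which another string branches off. -/
lemma hasSum_patriciaDepth (x : ℕ → BitString) {n : ℕ} (hn : 0 < n) :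
    HasSum (fun k => if ∃ j < n, (∀ i < k, x j i = x 0 i) ∧ x j k ≠ x 0 k then (1 : ℝ) else 0)
      (patriciaDepth x n) := by
  have hmem : x 0 ∈ firstStrings x n :=
    Finset.mem_image_of_mem x (Finset.mem_range.2 hn)
  have hsep := separatedWithin_separationLevel (firstStrings x n)
  rw [patriciaDepth, patriciaTrie, trie, depth_compress_buildTrie hsep hmem, Nat.cast_sum]
  have heq : ∀ k, (if ∃ j < n, (∀ i < k, x j i = x 0 i) ∧ x j k ≠ x 0 k then (1 : ℝ) else 0) =
      ((if ∃ t ∈ firstStrings x n, (∀ j < k, t (0 + j) = x 0 (0 + j)) ∧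
        t (0 + k) ≠ x 0 (0 + k) then 1 else 0 : ℕ) : ℝ) := by
    intro k
    simp [firstStrings]
  simp_rw [heq]
  refine hasSum_sum_of_ne_finset_zero fun k hk => ?_
  rw [Nat.cast_eq_zero]
  refine if_neg ?_
  rintro ⟨t, ht, hj, hne⟩
  refine hne (congrFun (hsep t ht (x 0) hmem fun i hi => hj i ?_) _)
  rw [Finset.mem_range] at hk
  omega

lemma trieDepth_zero (x : ℕ → BitString) : trieDepth x 0 = 0 := by
  simp [trieDepth, trie, firstStrings, buildTrie_empty, BinTree.depth]

lemma patriciaDepth_zero (x : ℕ → BitString) : patriciaDepth x 0 = 0 := by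
  simp [patriciaDepth, patriciaTrie, trie, firstStrings, buildTrie_empty, BinTree.depth,
    BinTree.compress]

/-! ### Word probabilities -/

/-- The probability of a letter. -/
def letterProb (p q : ℝ) (b : Bool) : ℝ := if b then p else q

/-- The probability that a random string starts with the word `w`. -/
def wordProb (p q : ℝ) {k : ℕ} (w : Fin k → Bool) : ℝ := ∏ i, letterProb p q (w i)

section Words

variable {p q : ℝ}

lemma letterProb_nonneg (hp : 0 ≤ p) (hq : 0 ≤ q) (b : Bool) : 0 ≤ letterProb p q b := by
  unfold letterProb; split_ifs <;> assumption

lemma letterProb_pos (hp : 0 < p) (hq : 0 < q) (b : Bool) : 0 < letterProb p q b := by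
  unfold letterProb; split_ifs <;> assumption

lemma wordProb_pos (hp : 0 < p) (hq : 0 < q) {k : ℕ} (w : Fin k → Bool) : 0 < wordProb p q w :=
  Finset.prod_pos fun _ _ => letterProb_pos hp hq _

lemma wordProb_cons {k : ℕ} (b : Bool) (w : Fin k → Bool) :
    wordProb p q (Fin.cons b w : Fin (k + 1) → Bool) = letterProb p q b * wordProb p q w := by
  simp [wordProb, Fin.prod_univ_succ]

lemma wordProb_snoc {k : ℕ} (w : Fin k → Bool) (b : Bool) :
    wordProb p q (Fin.snoc w b : Fin (k + 1) → Bool) = wordProb p q w * letterProb p q b := by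
  simp [wordProb, Fin.prod_univ_castSucc]

lemma sum_words_cons {M : Type*} [AddCommMonoid M] {k : ℕ} (f : (Fin (k + 1) → Bool) → M) :
    ∑ w, f w = ∑ w : Fin k → Bool, (f (Fin.cons true w) + f (Fin.cons false w)) := by
  rw [← (Fin.consEquiv fun _ => Bool).sum_comp, Fintype.sum_prod_type_right]
  simp [Fin.consEquiv]

lemma sum_words_snoc {M : Type*} [AddCommMonoid M] {k : ℕ} (f : (Fin (k + 1) → Bool) → M) :
    ∑ w, f w = ∑ w : Fin k → Bool,
      (f (Fin.snoc (α := fun _ => Bool) w true) + f (Fin.snoc (α := fun _ => Bool) w false)) := by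
  rw [← (Fin.snocEquiv fun _ => Bool).sum_comp, Fintype.sum_prod_type_right]
  simp [Fin.snocEquiv]

lemma sum_wordProb (hpq : p + q = 1) (k : ℕ) : ∑ w : Fin k → Bool, wordProb p q w = 1 := by
  induction k with
  | zero => simp [wordProb]
  | succ k ih =>
    rw [sum_words_cons, ← ih]
    refine Finset.sum_congr rfl fun w _ => ?_
    rw [wordProb_cons, wordProb_cons, ← add_mul]
    simp [letterProb, hpq]

lemma wordProb_le_one (hp : 0 < p) (hq : 0 < q) (hpq : p + q = 1) {k : ℕ} (w : Fin k → Bool) :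
    wordProb p q w ≤ 1 := by
  rw [← sum_wordProb hpq k]
  exact Finset.single_le_sum (fun v _ => (wordProb_pos hp hq v).le) (Finset.mem_univ w)

end Words

/-! ### Expected depths as sums over words -/

section Law

variable {Ω : Type*} [MeasurableSpace Ω] {μ : Measure Ω}

/-- Tonelli for a sum of indicators, taken in `ENNReal`. Measurability of `f` comes for free, as it
agrees almost everywhere with a measurable sum; so the measurability of the tree depths is never
examined. -/
lemma integrable_and_integral_of_hasSum_indicator {A : ℕ → Set Ω}
    (hA : ∀ k, MeasurableSet (A k)) (hfin : ∀ k, μ (A k) ≠ ⊤) {f : Ω → ℝ} {S : ℝ}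
    (hf : ∀ᵐ ω ∂μ, HasSum (fun k => (A k).indicator (fun _ => (1 : ℝ)) ω) (f ω))
    (hS : HasSum (fun k => μ.real (A k)) S) :
    Integrable f μ ∧ ∫ ω, f ω ∂μ = S := by
  set g : Ω → ENNReal := fun ω => ∑' k, (A k).indicator (fun _ => (1 : ENNReal)) ω with hg
  have hgm : Measurable g :=
    Measurable.tsum fun k => measurable_const.indicator (hA k)
  have hfg : f =ᵐ[μ] fun ω => (g ω).toReal := by
    filter_upwards [hf] with ω hω
    rw [hg, ENNReal.tsum_toReal_eq, ← hω.tsum_eq]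
    · refine tsum_congr fun k => ?_
      by_cases h : ω ∈ A k <;> simp [h]
    · intro k
      by_cases h : ω ∈ A k <;> simp [h]
  have hlin : ∫⁻ ω, g ω ∂μ = ∑' k, μ (A k) := by
    rw [hg, lintegral_tsum fun k => (measurable_const.indicator (hA k)).aemeasurable]
    refine tsum_congr fun k => ?_
    rw [lintegral_indicator (hA k)]
    simp
  have hne : ∑' k, μ (A k) ≠ ⊤ := by
    have : ∀ k, μ (A k) = ENNReal.ofReal (μ.real (A k)) := fun k =>
      (ofReal_measureReal (hfin k)).symm
    simp_rw [this]
    rw [← ENNReal.ofReal_tsum_of_nonneg (fun k => measureReal_nonneg) hS.summable]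
    exact ENNReal.ofReal_ne_top
  have hint : Integrable (fun ω => (g ω).toReal) μ :=
    integrable_toReal_of_lintegral_ne_top hgm.aemeasurable (hlin ▸ hne)
  refine ⟨hint.congr hfg.symm, ?_⟩
  rw [integral_congr_ae hfg, integral_toReal hgm.aemeasurable
    (ae_lt_top hgm (hlin ▸ hne)), hlin, ENNReal.tsum_toReal_eq hfin, ← hS.tsum_eq]
  rfl

variable {p q : ℝ} {ξ : ℕ → ℕ → Ω → Bool}

/-- Independent letters `ξ j i`, equal to `true` with probability `p`, where `j` numbers the
strings and `i` the positions. -/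
structure IsRandomStrings (μ : Measure Ω) (p q : ℝ) (ξ : ℕ → ℕ → Ω → Bool) : Prop where
  pos_left : 0 < p
  pos_right : 0 < q
  add_eq_one : p + q = 1
  measurable : ∀ j i, Measurable (ξ j i)
  indep : iIndepFun (fun ji : ℕ × ℕ => ξ ji.1 ji.2) μ
  law : ∀ j i, μ {ω | ξ j i ω = true} = ENNReal.ofReal p

/-- The prefix of length `k` of the string number `j`. -/
def stringPrefix (ξ : ℕ → ℕ → Ω → Bool) (k j : ℕ) (ω : Ω) : Fin k → Bool := fun i => ξ j i ω

namespace IsRandomStrings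

lemma measure_letter [IsProbabilityMeasure μ] (h : IsRandomStrings μ p q ξ) (j i : ℕ) (b : Bool) :
    μ (ξ j i ⁻¹' {b}) = ENNReal.ofReal (letterProb p q b) := by
  rcases b
  · have hc : ξ j i ⁻¹' {false} = {ω | ξ j i ω = true}ᶜ := by ext; simp
    rw [hc, prob_compl_eq_one_sub, h.law]
    · rw [← ENNReal.ofReal_one, ← ENNReal.ofReal_sub _ h.pos_left.le]
      congr 1
      simp [letterProb]
      linarith [h.add_eq_one]
    · exact h.measurable j i (measurableSet_singleton true)
  · have hc : ξ j i ⁻¹' {true} = {ω | ξ j i ω = true} := by ext; simp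
    rw [hc, h.law]; rfl

lemma measurable_stringPrefix (h : IsRandomStrings μ p q ξ) (k j : ℕ) :
    Measurable (stringPrefix ξ k j) :=
  measurable_pi_iff.2 fun i => h.measurable j i

lemma measure_stringPrefix [IsProbabilityMeasure μ] (h : IsRandomStrings μ p q ξ) (k j : ℕ)
    (w : Fin k → Bool) :
    μ (stringPrefix ξ k j ⁻¹' {w}) = ENNReal.ofReal (wordProb p q w) := by
  have hinj : Function.Injective (fun i : Fin k => (j, (i : ℕ))) := fun a b hab => by
    simpa [Fin.ext_iff] using hab
  have hset : stringPrefix ξ k j ⁻¹' {w} = ⋂ i : Fin k, ξ j i ⁻¹' {w i} := by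
    ext ω; simp [stringPrefix, funext_iff]
  rw [hset, (h.indep.precomp hinj).meas_iInter, wordProb,
    ENNReal.ofReal_prod_of_nonneg fun i _ =>
      letterProb_nonneg h.pos_left.le h.pos_right.le _]
  · exact Finset.prod_congr rfl fun i _ => h.measure_letter j i (w i)
  · exact fun i => ⟨{w i}, measurableSet_singleton _, rfl⟩

lemma iIndepFun_stringPrefix [IsProbabilityMeasure μ] (h : IsRandomStrings μ p q ξ) (k n : ℕ) :
    iIndepFun (fun j : Fin n => stringPrefix ξ k j) μ := by
  rw [iIndepFun_iff_map_fun_eq_pi_map fun j : Fin n =>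
    (h.measurable_stringPrefix k j).aemeasurable]
  have : ∀ j : Fin n, IsProbabilityMeasure (μ.map (stringPrefix ξ k j)) := fun j =>
    Measure.isProbabilityMeasure_map (h.measurable_stringPrefix k j).aemeasurable
  refine Measure.ext_of_singleton fun w => ?_
  have hmeas : Measurable fun ω (j : Fin n) => stringPrefix ξ k j ω :=
    measurable_pi_iff.2 fun j => h.measurable_stringPrefix k j
  rw [Measure.pi_singleton, Measure.map_apply hmeas (measurableSet_singleton w)]
  have hinj : Function.Injective (fun ji : Fin n × Fin k => ((ji.1 : ℕ), (ji.2 : ℕ))) :=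
    fun a b hab => by
      simpa [Prod.ext_iff, Fin.ext_iff] using hab
  have hset : (fun ω (j : Fin n) => stringPrefix ξ k j ω) ⁻¹' {w} =
      ⋂ ji : Fin n × Fin k, ξ ji.1 ji.2 ⁻¹' {w ji.1 ji.2} := by
    ext ω; simp [stringPrefix, funext_iff]
  rw [hset, (h.indep.precomp hinj).meas_iInter, Fintype.prod_prod_type]
  · refine Finset.prod_congr rfl fun j _ => ?_
    rw [Measure.map_apply (h.measurable_stringPrefix k j) (measurableSet_singleton _),
      h.measure_stringPrefix, wordProb, ENNReal.ofReal_prod_of_nonneg fun i _ =>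
      letterProb_nonneg h.pos_left.le h.pos_right.le _]
    exact Finset.prod_congr rfl fun i _ => h.measure_letter j i (w j i)
  · exact fun ji => ⟨{w ji.1 ji.2}, measurableSet_singleton _, rfl⟩

/-- No other string starts with the image under `f` of the prefix of the first string. -/
lemma measureReal_forall_stringPrefix_ne [IsProbabilityMeasure μ]
    (h : IsRandomStrings μ p q ξ) (k N : ℕ)
    (f : (Fin k → Bool) → (Fin k → Bool)) :
    μ.real {ω | ∀ j : Fin N, stringPrefix ξ k (j + 1) ω ≠ f (stringPrefix ξ k 0 ω)} =
      ∑ w, wordProb p q w * (1 - wordProb p q (f w)) ^ N := by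
  -- Condition on the prefix `w` of the first string: the event splits into disjoint cylinders, on
  -- each of which the prefixes of the `N + 1` strings are subject to independent constraints.
  have hset : {ω | ∀ j : Fin N, stringPrefix ξ k (j + 1) ω ≠ f (stringPrefix ξ k 0 ω)} =
      ⋃ w : Fin k → Bool, ⋂ j : Fin (N + 1),
        stringPrefix ξ k j ⁻¹' (Fin.cons {w} (fun _ => {f w}ᶜ) : Fin (N + 1) → Set _) j := by
    ext ω
    simp [Fin.forall_fin_succ]
  have hmeas : ∀ w : Fin k → Bool, ∀ j : Fin (N + 1), MeasurableSet (stringPrefix ξ k j ⁻¹'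
      (Fin.cons {w} (fun _ => {f w}ᶜ) : Fin (N + 1) → Set _) j) := fun w j =>
    h.measurable_stringPrefix k j (Set.toFinite _).measurableSet
  rw [hset, measureReal_iUnion_fintype]
  · refine Finset.sum_congr rfl fun w _ => ?_
    rw [Measure.real, (h.iIndepFun_stringPrefix k (N + 1)).meas_iInter, Fin.prod_univ_succ]
    · have h1 : μ (stringPrefix ξ k ((0 : Fin (N + 1)) : ℕ) ⁻¹' {w}) =
          ENNReal.ofReal (wordProb p q w) := h.measure_stringPrefix k _ w
      have h2 : ∀ j : Fin N, μ (stringPrefix ξ k (j.succ : Fin (N + 1)) ⁻¹' {f w}ᶜ) =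
          ENNReal.ofReal (1 - wordProb p q (f w)) := fun j => by
        rw [Set.preimage_compl, prob_compl_eq_one_sub
          (h.measurable_stringPrefix k _ (measurableSet_singleton _)), h.measure_stringPrefix,
          ENNReal.ofReal_sub _ (wordProb_pos h.pos_left h.pos_right _).le, ENNReal.ofReal_one]
      simp only [Fin.cons_zero, Fin.cons_succ, h1, h2, Finset.prod_const, Finset.card_univ,
        Fintype.card_fin, ENNReal.toReal_mul, ENNReal.toReal_pow]
      rw [ENNReal.toReal_ofReal (wordProb_pos h.pos_left h.pos_right _).le,
        ENNReal.toReal_ofReal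
          (sub_nonneg.2 (wordProb_le_one h.pos_left h.pos_right h.add_eq_one _))]
    · exact fun j => ⟨_, (Set.toFinite _).measurableSet, rfl⟩
  · intro v w hvw
    refine Set.disjoint_left.2 fun ω hv hw => hvw ?_
    have h1 := Set.mem_iInter.1 hv 0
    have h2 := Set.mem_iInter.1 hw 0
    simp at h1 h2
    rw [← h1, ← h2]
  · exact fun w => MeasurableSet.iInter (hmeas w)

/-- Another of the first `N + 1` strings shares the first `k` letters with the first one. -/
lemma measureReal_exists_agree [IsProbabilityMeasure μ] (h : IsRandomStrings μ p q ξ) (N k : ℕ) :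
    μ.real {ω | ∃ j < N + 1, j ≠ 0 ∧ ∀ i < k, ξ j i ω = ξ 0 i ω} =
      ∑ w : Fin k → Bool, wordProb p q w * (1 - (1 - wordProb p q w) ^ N) := by
  have hset : {ω | ∃ j < N + 1, j ≠ 0 ∧ ∀ i < k, ξ j i ω = ξ 0 i ω} =
      {ω | ∀ j : Fin N, stringPrefix ξ k (j + 1) ω ≠ id (stringPrefix ξ k 0 ω)}ᶜ := by
    ext ω
    simp only [Set.mem_ofPred_eq, Set.mem_compl_iff, not_forall, ne_eq, not_not, id]
    constructor
    · rintro ⟨j, hj, h0, hi⟩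
      refine ⟨⟨j - 1, by omega⟩, funext fun i => ?_⟩
      simp only [stringPrefix, Nat.sub_add_cancel (Nat.pos_of_ne_zero h0)]
      exact hi i i.2
    · rintro ⟨j, hj⟩
      exact ⟨j + 1, by omega, by omega, fun i hi => congrFun hj ⟨i, hi⟩⟩
  have hmeas : MeasurableSet
      {ω | ∀ j : Fin N, stringPrefix ξ k (j + 1) ω ≠ id (stringPrefix ξ k 0 ω)} := by
    rw [Set.ofPred_forall]
    exact MeasurableSet.iInter fun j => (measurableSet_eq_fun
      (h.measurable_stringPrefix k _) (h.measurable_stringPrefix k _)).compl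
  rw [hset, probReal_compl_eq_one_sub hmeas, h.measureReal_forall_stringPrefix_ne k N id]
  simp only [mul_sub, Finset.sum_sub_distrib, mul_one, sum_wordProb h.add_eq_one k, id]

/-- Another of the first `N + 1` strings shares exactly the first `k` letters with the first
one. -/
lemma measureReal_exists_branch [IsProbabilityMeasure μ]
    (h : IsRandomStrings μ p q ξ) (N k : ℕ) :
    μ.real {ω | ∃ j < N + 1, (∀ i < k, ξ j i ω = ξ 0 i ω) ∧ ξ j k ω ≠ ξ 0 k ω} =
      ∑ w : Fin k → Bool, wordProb p q w * (1 - p * (1 - wordProb p q w * q) ^ N -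
        q * (1 - wordProb p q w * p) ^ N) := by
  -- Branching off after exactly `k` letters means that the prefix of length `k + 1` is that of the
  -- first string with its last letter flipped.
  set f : (Fin (k + 1) → Bool) → (Fin (k + 1) → Bool) := fun w =>
    Fin.snoc (α := fun _ => Bool) (Fin.init w) (!(w (Fin.last k))) with hf
  have hset : {ω | ∃ j < N + 1, (∀ i < k, ξ j i ω = ξ 0 i ω) ∧ ξ j k ω ≠ ξ 0 k ω} =
      {ω | ∀ j : Fin N, stringPrefix ξ (k + 1) (j + 1) ω ≠ f (stringPrefix ξ (k + 1) 0 ω)}ᶜ := by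
    ext ω
    simp only [Set.mem_ofPred_eq, Set.mem_compl_iff, not_forall, ne_eq, not_not]
    constructor
    · rintro ⟨j, hj, hi, hne⟩
      have h0 : j ≠ 0 := by rintro rfl; exact hne rfl
      refine ⟨⟨j - 1, by omega⟩, funext fun i => ?_⟩
      simp only [stringPrefix, Nat.sub_add_cancel (Nat.pos_of_ne_zero h0), hf]
      refine Fin.lastCases ?_ (fun i => ?_) i
      · simpa [stringPrefix, Bool.eq_not_iff] using hne
      · simpa [Fin.init, stringPrefix] using hi i i.2
    · rintro ⟨j, hj⟩
      refine ⟨j + 1, by omega, fun i hi => ?_, ?_⟩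
      · have := congrFun hj (Fin.castSucc ⟨i, hi⟩)
        simp only [hf, Fin.snoc_castSucc (α := fun _ => Bool)] at this
        exact this
      · simpa [stringPrefix, hf, Bool.eq_not_iff] using congrFun hj (Fin.last k)
  have hmeas : MeasurableSet
      {ω | ∀ j : Fin N, stringPrefix ξ (k + 1) (j + 1) ω ≠ f (stringPrefix ξ (k + 1) 0 ω)} := by
    rw [Set.ofPred_forall]
    exact MeasurableSet.iInter fun j => (measurableSet_eq_fun
      (h.measurable_stringPrefix _ _)
      ((measurable_of_finite f).comp (h.measurable_stringPrefix _ _))).compl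
  rw [hset, probReal_compl_eq_one_sub hmeas, h.measureReal_forall_stringPrefix_ne (k + 1) N f,
    sum_words_snoc]
  simp only [hf, Fin.init_snoc, Fin.snoc_last, wordProb_snoc, mul_sub, Finset.sum_sub_distrib,
    mul_one, sum_wordProb h.add_eq_one k, Finset.sum_add_distrib, sub_sub]
  simp [letterProb, mul_assoc, mul_add, Finset.sum_add_distrib]

lemma measurableSet_agree (h : IsRandomStrings μ p q ξ) (j k : ℕ) :
    MeasurableSet {ω | ∀ i < k, ξ j i ω = ξ 0 i ω} := by
  simp only [Set.ofPred_forall]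
  exact MeasurableSet.iInter fun i => MeasurableSet.iInter fun _ =>
    measurableSet_eq_fun (h.measurable j i) (h.measurable 0 i)

lemma measurableSet_exists_agree (h : IsRandomStrings μ p q ξ) (N k : ℕ) :
    MeasurableSet {ω | ∃ j < N + 1, j ≠ 0 ∧ ∀ i < k, ξ j i ω = ξ 0 i ω} := by
  simp only [Set.ofPred_exists, Set.ofPred_and]
  exact MeasurableSet.iUnion fun j => (MeasurableSet.const _).inter
    ((MeasurableSet.const _).inter (h.measurableSet_agree j k))

lemma measurableSet_exists_branch (h : IsRandomStrings μ p q ξ) (N k : ℕ) :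
    MeasurableSet {ω | ∃ j < N + 1, (∀ i < k, ξ j i ω = ξ 0 i ω) ∧ ξ j k ω ≠ ξ 0 k ω} := by
  simp only [Set.ofPred_exists, Set.ofPred_and]
  exact MeasurableSet.iUnion fun j => (MeasurableSet.const _).inter
    ((h.measurableSet_agree j k).inter
      (measurableSet_eq_fun (h.measurable j k) (h.measurable 0 k)).compl)

theorem integral_patriciaDepth [IsProbabilityMeasure μ]
    (h : IsRandomStrings μ p q ξ) (N : ℕ) {S : ℝ}
    (hS : HasSum (fun k => ∑ w : Fin k → Bool, wordProb p q w *
      (1 - p * (1 - wordProb p q w * q) ^ N - q * (1 - wordProb p q w * p) ^ N)) S) :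
    Integrable (fun ω => (patriciaDepth (fun j i => ξ j i ω) (N + 1) : ℝ)) μ ∧
      ∫ ω, (patriciaDepth (fun j i => ξ j i ω) (N + 1) : ℝ) ∂μ = S := by
  refine integrable_and_integral_of_hasSum_indicator (h.measurableSet_exists_branch N)
    (fun k => measure_ne_top _ _) (ae_of_all _ fun ω => ?_)
    (by simpa only [h.measureReal_exists_branch] using hS)
  convert hasSum_patriciaDepth (fun j i => ξ j i ω) (Nat.succ_pos N) using 2 with k
  simp [Set.indicator_apply]

theorem integral_trieDepth [IsProbabilityMeasure μ]
    (h : IsRandomStrings μ p q ξ) (N : ℕ) {S : ℝ}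
    (hS : HasSum (fun k => ∑ w : Fin k → Bool, wordProb p q w *
      (1 - (1 - wordProb p q w) ^ N)) S) :
    Integrable (fun ω => (trieDepth (fun j i => ξ j i ω) (N + 1) : ℝ)) μ ∧
      ∫ ω, (trieDepth (fun j i => ξ j i ω) (N + 1) : ℝ) ∂μ = S := by
  have hS' : HasSum (fun k =>
      μ.real {ω | ∃ j < N + 1, j ≠ 0 ∧ ∀ i < k, ξ j i ω = ξ 0 i ω}) S := by
    simpa only [h.measureReal_exists_agree] using hS
  -- Equal strings collapse in the finite set of strings, so the level count needs distinct strings.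
  -- They are almost surely distinct: the probability of agreeing on `k` letters is the general term
  -- of a convergent series.
  have hdist : ∀ᵐ ω ∂μ, ∀ j < N + 1, j ≠ 0 → (fun i => ξ j i ω) ≠ fun i => ξ 0 i ω := by
    have hzero : μ.real {ω | ∃ j < N + 1, j ≠ 0 ∧ ∀ i, ξ j i ω = ξ 0 i ω} ≤ 0 :=
      ge_of_tendsto' hS'.summable.tendsto_atTop_zero fun k =>
        measureReal_mono fun ω ⟨j, hj, h0, hi⟩ => ⟨j, hj, h0, fun i _ => hi i⟩
    have hnull := (measureReal_eq_zero_iff (measure_ne_top _ _)).1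
      (le_antisymm hzero measureReal_nonneg)
    rw [ae_iff]
    convert hnull using 3 with ω
    simp [funext_iff]
  refine integrable_and_integral_of_hasSum_indicator (h.measurableSet_exists_agree N)
    (fun k => measure_ne_top _ _) ?_ hS'
  filter_upwards [hdist] with ω hω
  convert hasSum_trieDepth (fun j i => ξ j i ω) (Nat.succ_pos N) using 2 with k
  have hiff : (ω ∈ {ω | ∃ j < N + 1, j ≠ 0 ∧ ∀ i < k, ξ j i ω = ξ 0 i ω}) ↔
      ∃ j < N + 1, (fun i => ξ j i ω) ≠ (fun i => ξ 0 i ω) ∧ ∀ i < k, ξ j i ω = ξ 0 i ω := ?_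
  · by_cases hc : ω ∈ {ω | ∃ j < N + 1, j ≠ 0 ∧ ∀ i < k, ξ j i ω = ξ 0 i ω}
    · rw [Set.indicator_of_mem hc, if_pos (hiff.1 hc)]
    · rw [Set.indicator_of_notMem hc, if_neg (mt hiff.2 hc)]
  constructor
  · rintro ⟨j, hj, h0, hi⟩
    exact ⟨j, hj, hω j hj h0, hi⟩
  · rintro ⟨j, hj, hne, hi⟩
    exact ⟨j, hj, by rintro rfl; exact hne rfl, hi⟩

end IsRandomStrings

end Law

/-! ### The averaging operator and its potential -/

/-- One step of the random walk with increments `log p` and `log q`. -/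
def avg (p q : ℝ) (G : ℝ → ℝ) (t : ℝ) : ℝ := p * G (t + Real.log p) + q * G (t + Real.log q)

/-- The potential `∑ₖ Tᵏ G` of `G`, where `T = avg p q`. -/
def potential (p q : ℝ) (G : ℝ → ℝ) (t : ℝ) : ℝ := ∑' k, (avg p q)^[k] G t

section Potential

variable {p q : ℝ}

/-- Each step of the walk adds the logarithm of a letter probability, so `k` steps average over
words of length `k`. This turns the sums over words in the depth formulas into potentials. -/
lemma iterate_avg_eq_sum (hp : 0 < p) (hq : 0 < q) (k : ℕ) (G : ℝ → ℝ) (t : ℝ) :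
    (avg p q)^[k] G t =
      ∑ w : Fin k → Bool, wordProb p q w * G (t + Real.log (wordProb p q w)) := by
  induction k generalizing G with
  | zero => simp [wordProb]
  | succ k ih =>
    rw [Function.iterate_succ_apply, ih, sum_words_cons]
    refine Finset.sum_congr rfl fun w _ => ?_
    have hw := (wordProb_pos hp hq w).ne'
    rw [wordProb_cons, wordProb_cons, Real.log_mul (letterProb_pos hp hq _).ne' hw,
      Real.log_mul (letterProb_pos hp hq _).ne' hw, avg]
    simp only [letterProb, if_true, Bool.false_eq_true, if_false]
    rw [show t + Real.log (wordProb p q w) + Real.log p =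
      t + (Real.log p + Real.log (wordProb p q w)) by ring,
      show t + Real.log (wordProb p q w) + Real.log q =
      t + (Real.log q + Real.log (wordProb p q w)) by ring]
    ring

lemma iterate_avg_mono (hp : 0 < p) (hq : 0 < q) {F G : ℝ → ℝ} (h : ∀ t, F t ≤ G t) (k : ℕ)
    (t : ℝ) : (avg p q)^[k] F t ≤ (avg p q)^[k] G t := by
  rw [iterate_avg_eq_sum hp hq, iterate_avg_eq_sum hp hq]
  exact Finset.sum_le_sum fun w _ => mul_le_mul_of_nonneg_left (h _) (wordProb_pos hp hq w).le

lemma abs_iterate_avg_le (hp : 0 < p) (hq : 0 < q) (G : ℝ → ℝ) (k : ℕ) (t : ℝ) :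
    |(avg p q)^[k] G t| ≤ (avg p q)^[k] (fun s => |G s|) t := by
  rw [iterate_avg_eq_sum hp hq, iterate_avg_eq_sum hp hq]
  refine (Finset.abs_sum_le_sum_abs _ _).trans (Finset.sum_le_sum fun w _ => ?_)
  rw [abs_mul, abs_of_pos (wordProb_pos hp hq w)]

lemma iterate_avg_sub (hp : 0 < p) (hq : 0 < q) (F G : ℝ → ℝ) (k : ℕ) (t : ℝ) :
    (avg p q)^[k] (fun s => F s - G s) t = (avg p q)^[k] F t - (avg p q)^[k] G t := by
  simp only [iterate_avg_eq_sum hp hq, mul_sub, Finset.sum_sub_distrib]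

lemma iterate_avg_add (hp : 0 < p) (hq : 0 < q) (F G : ℝ → ℝ) (k : ℕ) (t : ℝ) :
    (avg p q)^[k] (fun s => F s + G s) t = (avg p q)^[k] F t + (avg p q)^[k] G t := by
  simp only [iterate_avg_eq_sum hp hq, mul_add, Finset.sum_add_distrib]

lemma iterate_avg_const_mul (hp : 0 < p) (hq : 0 < q) (c : ℝ) (G : ℝ → ℝ) (k : ℕ) (t : ℝ) :
    (avg p q)^[k] (fun s => c * G s) t = c * (avg p q)^[k] G t := by
  simp only [iterate_avg_eq_sum hp hq, mul_left_comm _ c, Finset.mul_sum]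

lemma iterate_avg_shift (hp : 0 < p) (hq : 0 < q) (c : ℝ) (G : ℝ → ℝ) (k : ℕ) (t : ℝ) :
    (avg p q)^[k] (fun s => G (s + c)) t = (avg p q)^[k] G (t + c) := by
  simp only [iterate_avg_eq_sum hp hq, add_right_comm t _ c]

/-- The logistic function. -/
def logistic (t : ℝ) : ℝ := Real.exp t / (1 + Real.exp t)

lemma logistic_nonneg (t : ℝ) : 0 ≤ logistic t := by unfold logistic; positivity

lemma logistic_le_one (t : ℝ) : logistic t ≤ 1 := by
  unfold logistic
  rw [div_le_one (by positivity)]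
  linarith

lemma logistic_le_exp (t : ℝ) : logistic t ≤ Real.exp t :=
  div_le_self (Real.exp_pos t).le (by linarith [Real.exp_pos t])

lemma exp_neg_abs_le (t : ℝ) : Real.exp (-|t|) ≤ 4 * (Real.exp t / (1 + Real.exp t) ^ 2) := by
  have hx := Real.exp_pos t
  rw [← mul_div_assoc, le_div_iff₀ (by positivity)]
  rcases le_total 0 t with h | h
  · have h1 : 1 ≤ Real.exp t := Real.one_le_exp h
    rw [abs_of_nonneg h, Real.exp_neg, inv_mul_le_iff₀ hx]
    nlinarith
  · have h1 : Real.exp t ≤ 1 := Real.exp_le_one_iff.2 h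
    rw [abs_of_nonpos h, neg_neg]
    nlinarith [mul_le_mul h1 h1 hx.le zero_le_one]

/-- The logistic function is strictly superharmonic for the walk. With `x = exp t` and a letter of
probability `c`, its decrease is `(1 - c)x / ((1 + x)(1 + cx))`, at least `(1 - c)x / (1 + x)²`.
Averaging gives the factor `2pq`, and `x / (1 + x)² ≥ exp(-|t|)/4`. -/
lemma exp_neg_abs_le_logistic_sub (hp : 0 < p) (hq : 0 < q) (hpq : p + q = 1) (t : ℝ) :
    p * q / 2 * Real.exp (-|t|) ≤ logistic t - avg p q logistic t := by
  have hx := Real.exp_pos t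
  have hshift : ∀ c : ℝ, 0 < c → c ≤ 1 →
      (1 - c) * (Real.exp t / (1 + Real.exp t) ^ 2) ≤ logistic t - logistic (t + Real.log c) := by
    intro c hc hc1
    rw [logistic, logistic, Real.exp_add, Real.exp_log hc, div_sub_div _ _ (by positivity)
      (by positivity), ← mul_div_assoc]
    have e1 : Real.exp t * (1 + Real.exp t * c) - (1 + Real.exp t) * (Real.exp t * c) =
      (1 - c) * Real.exp t := by ring
    rw [e1]
    have h0 : 0 ≤ (1 - c) * Real.exp t := mul_nonneg (by linarith) hx.le
    gcongr
    nlinarith [mul_nonneg hx.le (sub_nonneg.2 hc1)]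
  have h1 := mul_le_mul_of_nonneg_left (hshift p hp (by linarith)) hp.le
  have h2 := mul_le_mul_of_nonneg_left (hshift q hq (by linarith)) hq.le
  have h3 := mul_le_mul_of_nonneg_left (exp_neg_abs_le t) (mul_pos hp hq).le
  rw [show 1 - p = q by linarith] at h1
  rw [show 1 - q = p by linarith] at h2
  have h4 : logistic t = p * logistic t + q * logistic t := by rw [← add_mul, hpq, one_mul]
  rw [h4, avg]
  linarith

/-- The superharmonic bound telescopes under iteration. This single estimate controls every
potential below and also the total error of the Poisson approximation. -/
lemma sum_iterate_avg_exp_neg_abs_le (hp : 0 < p) (hq : 0 < q) (hpq : p + q = 1) (n : ℕ)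
    (t : ℝ) : ∑ k ∈ Finset.range n, (avg p q)^[k] (fun s => Real.exp (-|s|)) t ≤
      2 / (p * q) * logistic t := by
  have hpq0 := mul_pos hp hq
  have hstep : ∀ k, p * q / 2 * (avg p q)^[k] (fun s => Real.exp (-|s|)) t ≤
      (avg p q)^[k] logistic t - (avg p q)^[k + 1] logistic t := by
    intro k
    rw [← iterate_avg_const_mul hp hq, Function.iterate_succ_apply, ← iterate_avg_sub hp hq]
    exact iterate_avg_mono hp hq (exp_neg_abs_le_logistic_sub hp hq hpq) k t
  have hsum := Finset.sum_le_sum fun k (_ : k ∈ Finset.range n) => hstep k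
  rw [Finset.sum_range_sub', ← Finset.mul_sum] at hsum
  have hnonneg : 0 ≤ (avg p q)^[n] logistic t := by
    rw [iterate_avg_eq_sum hp hq]
    exact Finset.sum_nonneg fun w _ => mul_nonneg (wordProb_pos hp hq w).le (logistic_nonneg _)
  rw [div_mul_eq_mul_div, le_div_iff₀ hpq0]
  simp only [Function.iterate_zero, id] at hsum
  linarith

variable {G : ℝ → ℝ} {M : ℝ}

lemma sum_abs_iterate_avg_le (hp : 0 < p) (hq : 0 < q) (hpq : p + q = 1)
    (hG : ∀ t, |G t| ≤ M * Real.exp (-|t|)) (n : ℕ) (t : ℝ) :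
    ∑ k ∈ Finset.range n, |(avg p q)^[k] G t| ≤ M * (2 / (p * q) * logistic t) := by
  have hM : 0 ≤ M := by
    have := (abs_nonneg _).trans (hG 0)
    simpa using this
  calc ∑ k ∈ Finset.range n, |(avg p q)^[k] G t|
      ≤ ∑ k ∈ Finset.range n, M * (avg p q)^[k] (fun s => Real.exp (-|s|)) t := by
        refine Finset.sum_le_sum fun k _ => (abs_iterate_avg_le hp hq G k t).trans ?_
        rw [← iterate_avg_const_mul hp hq]
        exact iterate_avg_mono hp hq hG k t
    _ ≤ M * (2 / (p * q) * logistic t) := by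
        rw [← Finset.mul_sum]
        exact mul_le_mul_of_nonneg_left (sum_iterate_avg_exp_neg_abs_le hp hq hpq n t) hM

lemma summable_iterate_avg (hp : 0 < p) (hq : 0 < q) (hpq : p + q = 1)
    (hG : ∀ t, |G t| ≤ M * Real.exp (-|t|)) (t : ℝ) :
    Summable fun k => (avg p q)^[k] G t :=
  (summable_of_sum_range_le (fun _ => abs_nonneg _)
    fun n => sum_abs_iterate_avg_le hp hq hpq hG n t).of_abs

/-- The logistic majorant serves twice: it is at most `1`, so the potential is bounded, and at most
`exp t`, so the potential can be integrated or summed towards `-∞`. -/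
lemma abs_potential_le (hp : 0 < p) (hq : 0 < q) (hpq : p + q = 1)
    (hG : ∀ t, |G t| ≤ M * Real.exp (-|t|)) (t : ℝ) :
    |potential p q G t| ≤ M * (2 / (p * q)) * logistic t := by
  rw [mul_assoc]
  refine le_of_tendsto ((summable_iterate_avg hp hq hpq hG t).hasSum.tendsto_sum_nat.abs)
    (Eventually.of_forall fun n => ?_)
  exact (Finset.abs_sum_le_sum_abs _ _).trans (sum_abs_iterate_avg_le hp hq hpq hG n t)

lemma potential_eq (hp : 0 < p) (hq : 0 < q) (hpq : p + q = 1)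
    (hG : ∀ t, |G t| ≤ M * Real.exp (-|t|)) (t : ℝ) :
    potential p q G t = G t + (p * potential p q G (t + Real.log p) +
      q * potential p q G (t + Real.log q)) := by
  have hs := summable_iterate_avg hp hq hpq hG
  rw [potential, (hs t).tsum_eq_zero_add]
  simp only [Function.iterate_zero, id, Function.iterate_succ_apply', potential]
  congr 1
  simp only [avg]
  rw [((hs _).mul_left p).tsum_add ((hs _).mul_left q), tsum_mul_left, tsum_mul_left]

/-- The potential commutes with shifts, so its increment is the potential of the increment of `G`.
For `|δ| ≤ 1` the latter is at most `M' e |δ| exp(-|s|)` by the mean value inequality, the factor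
`e` paying for moving the base point by at most `1`. -/
lemma uniformContinuous_potential (hp : 0 < p) (hq : 0 < q) (hpq : p + q = 1)
    (hG : ∀ t, |G t| ≤ M * Real.exp (-|t|)) {G' : ℝ → ℝ} {M' : ℝ}
    (hderiv : ∀ t, HasDerivAt G (G' t) t) (hG' : ∀ t, |G' t| ≤ M' * Real.exp (-|t|)) :
    UniformContinuous (potential p q G) := by
  have hM' : 0 ≤ M' := by
    have := (abs_nonneg _).trans (hG' 0)
    simpa using this
  set K : ℝ := M' * Real.exp 1 * (2 / (p * q)) with hK
  have hK0 : 0 ≤ K := by positivity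
  have hs := summable_iterate_avg hp hq hpq hG
  have hlip : ∀ t δ, |δ| ≤ 1 → |potential p q G (t + δ) - potential p q G t| ≤ K * |δ| := by
    intro t δ hδ
    have hdiff : ∀ s, |G (s + δ) - G s| ≤ (M' * Real.exp 1 * |δ|) * Real.exp (-|s|) := by
      intro s
      have := (convex_uIcc s (s + δ)).norm_image_sub_le_of_norm_hasDerivWithin_le
        (f := G) (f' := G') (C := M' * Real.exp 1 * Real.exp (-|s|))
        (fun x _ => (hderiv x).hasDerivWithinAt) (fun x hx => ?_)
        Set.left_mem_uIcc Set.right_mem_uIcc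
      · rw [Real.norm_eq_abs, Real.norm_eq_abs, add_sub_cancel_left] at this
        linarith
      · rw [Real.norm_eq_abs, mul_assoc, ← Real.exp_add]
        refine (hG' x).trans (mul_le_mul_of_nonneg_left (Real.exp_le_exp.2 ?_) hM')
        have h1 : |x - s| ≤ 1 := (Set.abs_sub_left_of_mem_uIcc hx).trans (by simpa using hδ)
        have h2 := abs_sub_abs_le_abs_sub s x
        rw [abs_sub_comm] at h2
        linarith
    have hpot : potential p q (fun s => G (s + δ) - G s) t =
        potential p q G (t + δ) - potential p q G t := by
      rw [potential, potential, potential, ← (hs _).tsum_sub (hs _)]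
      refine tsum_congr fun k => ?_
      rw [iterate_avg_sub hp hq, iterate_avg_shift hp hq]
    rw [← hpot]
    refine (abs_potential_le hp hq hpq hdiff t).trans ?_
    have h0 : 0 ≤ M' * Real.exp 1 * |δ| * (2 / (p * q)) := by positivity
    calc _ ≤ M' * Real.exp 1 * |δ| * (2 / (p * q)) * 1 :=
          mul_le_mul_of_nonneg_left (logistic_le_one t) h0
      _ = K * |δ| := by rw [hK]; ring
  rw [Metric.uniformContinuous_iff]
  intro ε hε
  refine ⟨min 1 (ε / (K + 1)), by positivity, fun {a b} hab => ?_⟩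
  rw [Real.dist_eq] at hab ⊢
  have h1 := hlip b (a - b) (hab.le.trans (min_le_left _ _))
  rw [add_sub_cancel] at h1
  have h2 : |a - b| * (K + 1) < ε := by
    rw [← lt_div_iff₀ (by positivity)]
    exact hab.trans_le (min_le_right _ _)
  nlinarith [abs_nonneg (a - b)]

end Potential

/-! ### Asymptotic periods of solutions of the renewal equation -/

section RenewalEquation

variable {p q u v B : ℝ} {Z G : ℝ → ℝ}

/-- The differences of a bounded solution of the renewal equation do not stay above a positive
constant. -/
lemma eventually_sub_shift_lt (hp : 0 < p) (hq : 0 < q) (hpq : p + q = 1)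
    (hZ : ∀ t, |Z t| ≤ B) (hG : Tendsto G atTop (𝓝 0))
    (heq : ∀ t, Z t = G t + (p * Z (t + u) + q * Z (t + v))) {ε : ℝ} (hε : 0 < ε) :
    ∀ᶠ t in atTop, Z t - Z (t + u) < ε := by
  set Δ : ℝ → ℝ := fun t => Z t - Z (t + u) with hΔ
  set g : ℝ → ℝ := fun t => G t - G (t + u) with hg
  have hg0 : Tendsto g atTop (𝓝 0) := by
    simpa using hG.sub (hG.comp (tendsto_atTop_add_const_right atTop u tendsto_id))
  have hΔeq : ∀ t, Δ t = g t + (p * Δ (t + u) + q * Δ (t + v)) := by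
    intro t
    simp only [hΔ, hg]
    have h1 := heq t
    have h2 := heq (t + u)
    rw [add_right_comm t u v] at h2
    linarith
  have hΔB : ∀ t, |Δ t| ≤ 2 * B := fun t => by
    have := abs_sub (Z t) (Z (t + u))
    linarith [hZ t, hZ (t + u)]
  have hbdd : IsBoundedUnder (· ≤ ·) atTop Δ :=
    isBoundedUnder_of ⟨2 * B, fun t => (abs_le.1 (hΔB t)).2⟩
  have hcobdd : IsCoboundedUnder (· ≤ ·) atTop Δ :=
    (isBoundedUnder_of ⟨-(2 * B), fun t => (abs_le.1 (hΔB t)).1⟩ :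
      IsBoundedUnder (· ≥ ·) atTop Δ).isCoboundedUnder_le
  -- A maximum principle at infinity. Where `Δ` is close to its upper limit `s`, its average over `t
  -- + u` and `t + v` is too, and neither value can exceed `s` by much, so `Δ(t + u)` is close to
  -- `s` as well.
  set s := limsup Δ atTop with hs
  have hup : ∀ a, s < a → ∀ᶠ t in atTop, Δ t < a := fun a ha => eventually_lt_of_limsup_lt ha hbdd
  have hlow : ∀ a, a < s → ∃ᶠ t in atTop, a < Δ t :=
    fun a ha => frequently_lt_of_lt_limsup hcobdd ha
  have hcl : MapClusterPt s atTop Δ := by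
    rw [mapClusterPt_iff_frequently]
    intro S hS
    obtain ⟨a, b, ⟨ha, hb⟩, hsub⟩ := mem_nhds_iff_exists_Ioo_subset.1 hS
    exact ((hlow a ha).and_eventually (hup b hb)).mono fun t ht => hsub ⟨ht.1, ht.2⟩
  -- One ultrafilter realizes the upper limit and serves for all shifts `t + i u` at once; they
  -- still tend to infinity along it, since `i` is fixed.
  obtain ⟨l, hl, hls⟩ := mapClusterPt_iff_ultrafilter.1 hcl
  have hshift : ∀ c : ℝ, Tendsto (fun t => t + c) (l : Filter ℝ) atTop := fun c =>
    (tendsto_atTop_add_const_right atTop c tendsto_id).mono_left hl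
  have hiter : ∀ i : ℕ, Tendsto (fun t => Δ (t + i * u)) l (𝓝 s) := by
    intro i
    induction i with
    | zero => simpa using hls
    | succ i ih =>
      have hnext : ∀ t, t + ((i + 1 : ℕ) : ℝ) * u = t + i * u + u := fun t => by push_cast; ring
      simp only [hnext]
      rw [tendsto_order]
      refine ⟨fun a ha => ?_, fun a ha => ?_⟩
      -- A third of `p (s - a)` for each of three errors: the distance of `Δ` to `s`, the size of
      -- `g`, and the excess of `Δ(t + v)` over `s`.
      · set η := p * (s - a) / 3 with hη
        have hη0 : 0 < η := by have := sub_pos.2 ha; positivity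
        filter_upwards [ih.eventually (lt_mem_nhds (show s - η < s by linarith)),
          (hg0.comp (hshift (i * u))).eventually (gt_mem_nhds hη0),
          (hshift (i * u + v)).eventually (hup (s + η) (by linarith))] with t h1 h2 h3
        have h4 := hΔeq (t + i * u)
        simp only [Function.comp] at h2
        rw [← add_assoc] at h3
        have h5 : q * Δ (t + i * u + v) ≤ q * s + η := by
          have := mul_le_mul_of_nonneg_left h3.le hq.le
          nlinarith
        have h6 : p * a < p * Δ (t + i * u + u) := by
          have : q * s = s - p * s := by rw [show q = 1 - p by linarith]; ring
          have h7 : 3 * η = p * s - p * a := by rw [hη]; ring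
          linarith
        exact lt_of_mul_lt_mul_left h6 hp.le
      · have := (hshift (i * u + u)).eventually (hup a ha)
        filter_upwards [this] with t ht
        rwa [← add_assoc] at ht
  -- The sum of `N` consecutive differences telescopes to a difference of two values of `Z`, so it
  -- stays below `2B` while tending to `N s`. This forces `s ≤ 0`.
  have hsum : ∀ N : ℕ, N * s ≤ 2 * B := by
    intro N
    have htend : Tendsto (fun t => ∑ i ∈ Finset.range N, Δ (t + i * u)) l (𝓝 (N * s)) := by
      have := tendsto_finsetSum (Finset.range N) fun i _ => hiter i
      simpa using this
    refine le_of_tendsto' htend fun t => ?_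
    have htel : ∑ i ∈ Finset.range N, Δ (t + i * u) = Z t - Z (t + N * u) := by
      have := Finset.sum_range_sub' (fun i : ℕ => Z (t + i * u)) N
      simp only [Nat.cast_zero, zero_mul, add_zero] at this
      rw [← this]
      refine Finset.sum_congr rfl fun i _ => ?_
      simp only [hΔ]
      push_cast
      congr 2
      ring
    rw [htel]
    have := abs_sub (Z t) (Z (t + N * u))
    linarith [hZ t, hZ (t + N * u), le_abs_self (Z t - Z (t + N * u))]
  have hs0 : s ≤ 0 := by
    by_contra! hpos
    obtain ⟨N, hN⟩ := exists_nat_gt (2 * B / s)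
    rw [div_lt_iff₀ hpos] at hN
    exact absurd (hsum N) (not_le.2 hN)
  exact hup ε (by linarith)

/-- The one-sided bound applies to `-Z` too, which solves the equation with `-G`. -/
lemma tendsto_sub_shift (hp : 0 < p) (hq : 0 < q) (hpq : p + q = 1)
    (hZ : ∀ t, |Z t| ≤ B) (hG : Tendsto G atTop (𝓝 0))
    (heq : ∀ t, Z t = G t + (p * Z (t + u) + q * Z (t + v))) :
    Tendsto (fun t => Z t - Z (t + u)) atTop (𝓝 0) := by
  rw [tendsto_order]
  refine ⟨fun a ha => ?_, fun a ha => eventually_sub_shift_lt hp hq hpq hZ hG heq ha⟩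
  have := eventually_sub_shift_lt (Z := fun t => -Z t) (G := fun t => -G t) (u := u) (v := v)
    hp hq hpq (fun t => by rw [abs_neg]; exact hZ t) (by simpa using hG.neg)
    (fun t => by rw [heq t]; ring) (neg_pos.2 ha)
  filter_upwards [this] with t ht
  linarith

/-- The asymptotic periods of a function. -/
def asymptoticPeriods (Z : ℝ → ℝ) : AddSubgroup ℝ where
  carrier := {s | Tendsto (fun t => Z t - Z (t + s)) atTop (𝓝 0)}
  zero_mem' := by simp
  add_mem' := by
    intro a b ha hb
    have := Tendsto.add ha (hb.comp (tendsto_atTop_add_const_right atTop a tendsto_id))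
    simpa [Function.comp_def, add_assoc] using this
  neg_mem' := by
    intro a ha
    have := (ha.comp (tendsto_atTop_add_const_right atTop (-a) tendsto_id)).neg
    simpa [Function.comp_def] using this

lemma mem_asymptoticPeriods {s : ℝ} :
    s ∈ asymptoticPeriods Z ↔ Tendsto (fun t => Z t - Z (t + s)) atTop (𝓝 0) := Iff.rfl

lemma closure_le_asymptoticPeriods (hp : 0 < p) (hq : 0 < q) (hpq : p + q = 1)
    (hZ : ∀ t, |Z t| ≤ B) (hG : Tendsto G atTop (𝓝 0))
    (heq : ∀ t, Z t = G t + (p * Z (t + u) + q * Z (t + v))) :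
    AddSubgroup.closure {u, v} ≤ asymptoticPeriods Z := by
  rw [AddSubgroup.closure_le]
  rintro s (rfl | rfl)
  · exact tendsto_sub_shift hp hq hpq hZ hG heq
  · exact tendsto_sub_shift hq hp (by linarith) hZ hG fun t => by rw [heq t]; ring

/-- Uniform continuity makes the group of asymptotic periods closed. -/
lemma asymptoticPeriods_eq_top (hZ : UniformContinuous Z)
    (hd : Dense (asymptoticPeriods Z : Set ℝ)) : asymptoticPeriods Z = ⊤ := by
  rw [eq_top_iff]
  intro s _
  rw [mem_asymptoticPeriods, Metric.tendsto_nhds]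
  intro ε hε
  obtain ⟨δ, hδ, hZδ⟩ := Metric.uniformContinuous_iff.1 hZ (ε / 2) (half_pos hε)
  obtain ⟨r, hr, hrs⟩ := hd.exists_dist_lt s hδ
  filter_upwards [(Metric.tendsto_nhds.1 (mem_asymptoticPeriods.1 hr)) (ε / 2) (half_pos hε)]
    with t ht
  have h1 : dist (Z (t + s)) (Z (t + r)) < ε / 2 := hZδ (by simpa using hrs)
  rw [Real.dist_eq] at ht h1 ⊢
  rw [abs_lt] at *
  constructor <;> linarith

end RenewalEquation

/-! ### Renewal theorems: the dense case and the lattice case -/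

section RenewalLimit

variable {p q u v B C : ℝ} {Z G : ℝ → ℝ}

lemma integrableOn_Iic_of_le_exp (hZc : Continuous Z) (hZe : ∀ t, |Z t| ≤ C * Real.exp t) (t : ℝ) :
    IntegrableOn Z (Set.Iic t) := by
  refine Integrable.mono' ((integrableOn_exp_Iic t).const_mul C) hZc.aestronglyMeasurable ?_
  exact ae_of_all _ fun s => hZe s

lemma setIntegral_Iic_sub_shift (hZc : Continuous Z) (hZe : ∀ t, |Z t| ≤ C * Real.exp t)
    (t u : ℝ) : ∫ x in Set.Iic t, (Z x - Z (x + u)) = ∫ s in u..0, Z (t + s) := by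
  have hi := integrableOn_Iic_of_le_exp hZc hZe
  have hshift : IntegrableOn (fun x => Z (x + u)) (Set.Iic t) := by
    refine integrableOn_Iic_of_le_exp (C := C * Real.exp u) (by fun_prop) (fun s => ?_) t
    rw [mul_assoc, ← Real.exp_add, add_comm u]
    exact hZe _
  have hcv : ∫ x in Set.Iic t, Z (x + u) = ∫ x in Set.Iic (t + u), Z x := by
    have hpre : (fun x => x + u) ⁻¹' Set.Iic (t + u) = Set.Iic t := by
      ext x; simp
    rw [← hpre]
    exact (measurePreserving_add_right volume u).setIntegral_preimage_emb
      (measurableEmbedding_addRight u) _ _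
  rw [integral_sub (hi t) hshift, hcv, intervalIntegral.integral_Iic_sub_Iic (hi _) (hi _),
    intervalIntegral.integral_comp_add_left, add_zero]

lemma tendsto_intervalIntegral_sub (hZc : Continuous Z) (hZ : ∀ t, |Z t| ≤ B)
    (hper : asymptoticPeriods Z = ⊤) (u : ℝ) :
    Tendsto (fun t => (-u) * Z t - ∫ s in u..0, Z (t + s)) atTop (𝓝 0) := by
  have hint : ∀ t, ∫ s in u..0, (Z t - Z (t + s)) = (-u) * Z t - ∫ s in u..0, Z (t + s) := by
    intro t
    rw [intervalIntegral.integral_sub (by simp)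
      ((by fun_prop : Continuous fun s => Z (t + s)).intervalIntegrable _ _)]
    simp
  simp_rw [← hint]
  have := intervalIntegral.tendsto_integral_filter_of_dominated_convergence (μ := volume)
    (l := (atTop : Filter ℝ)) (a := u) (b := 0) (F := fun t s => Z t - Z (t + s))
    (f := fun _ => 0) (fun _ => 2 * B)
    (Eventually.of_forall fun t =>
      (by fun_prop : Continuous fun s => Z t - Z (t + s)).aestronglyMeasurable)
    (Eventually.of_forall fun t => ae_of_all _ fun s _ => ?_) (by simp)
    (ae_of_all _ fun s _ => ?_)
  · simpa using this
  · have := abs_sub (Z t) (Z (t + s))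
    rw [Real.norm_eq_abs]
    linarith [hZ t, hZ (t + s)]
  · have : s ∈ asymptoticPeriods Z := by rw [hper]; trivial
    exact mem_asymptoticPeriods.1 this

/-- The renewal theorem for a solution of the renewal equation all of whose shifts are
asymptotically equal. -/
theorem tendsto_of_asymptoticPeriods_eq_top (hpq : p + q = 1)
    (hZc : Continuous Z) (hZ : ∀ t, |Z t| ≤ B) (hZe : ∀ t, |Z t| ≤ C * Real.exp t)
    (hGi : Integrable G) (heq : ∀ t, Z t = G t + (p * Z (t + u) + q * Z (t + v)))
    (hper : asymptoticPeriods Z = ⊤) (hH : 0 < -(p * u + q * v)) :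
    Tendsto Z atTop (𝓝 ((∫ t, G t) / -(p * u + q * v))) := by
  -- Since `p + q = 1`, the equation writes `G` as a mixture of the differences `Z x - Z (x + u)`
  -- and `Z x - Z (x + v)`. Integrated over a half-line, each difference leaves only a bounded
  -- window next to `t`.
  have hI : ∀ t, ∫ x in Set.Iic t, G x =
      p * (∫ s in u..0, Z (t + s)) + q * ∫ s in v..0, Z (t + s) := by
    intro t
    rw [← setIntegral_Iic_sub_shift hZc hZe, ← setIntegral_Iic_sub_shift hZc hZe,
      ← integral_const_mul, ← integral_const_mul, ← integral_add]
    · refine integral_congr_ae (ae_of_all _ fun x => ?_)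
      have h1 := heq x
      have h2 : Z x = p * Z x + q * Z x := by rw [← add_mul, hpq, one_mul]
      simp only
      linarith
    all_goals
      refine Integrable.const_mul ?_ _
      refine (integrableOn_Iic_of_le_exp hZc hZe t).sub ?_
    · refine integrableOn_Iic_of_le_exp (C := C * Real.exp u) (by fun_prop) (fun s => ?_) t
      rw [mul_assoc, ← Real.exp_add, add_comm u]
      exact hZe _
    · refine integrableOn_Iic_of_le_exp (C := C * Real.exp v) (by fun_prop) (fun s => ?_) t
      rw [mul_assoc, ← Real.exp_add, add_comm v]
      exact hZe _
  have hlim : Tendsto (fun t => ∫ x in Set.Iic t, G x) atTop (𝓝 (∫ t, G t)) :=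
    (aecover_Iic tendsto_id).integral_tendsto_of_countably_generated hGi
  -- On bounded windows `Z` is asymptotically constant, so the window integrals are `-u Z t + o(1)`
  -- and `-v Z t + o(1)`, and `Z t` can be solved for.
  have h1 := ((tendsto_intervalIntegral_sub hZc hZ hper u).const_mul p).add
    ((tendsto_intervalIntegral_sub hZc hZ hper v).const_mul q)
  have h2 := (h1.add hlim).div_const (-(p * u + q * v))
  simp only [mul_zero, add_zero, zero_add] at h2
  refine h2.congr fun t => ?_
  rw [hI t, div_eq_iff hH.ne']
  ring

variable {M d : ℝ}

lemma summable_exp_neg_nat_mul (hd : 0 < d) : Summable fun j : ℕ => Real.exp (-(j * d)) := by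
  have := summable_geometric_of_lt_one (Real.exp_pos (-d)).le (Real.exp_lt_one_iff.2 (neg_lt_zero.2 hd))
  refine this.congr fun j => ?_
  rw [← Real.exp_nat_mul]
  congr 1
  ring

lemma summable_lattice (hd : 0 < d) (hZe : ∀ t, |Z t| ≤ C * Real.exp t) (t : ℝ) :
    Summable fun j : ℕ => Z (t - j * d) := by
  refine Summable.of_norm_bounded
    (((summable_exp_neg_nat_mul hd).mul_left (C * Real.exp t))) fun j => ?_
  rw [mul_assoc, ← Real.exp_add, ← sub_eq_add_neg]
  exact hZe _

lemma summable_int_lattice (hd : 0 < d) (hG : ∀ t, |G t| ≤ M * Real.exp (-|t|)) (t : ℝ) :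
    Summable fun j : ℤ => G (t + j * d) := by
  have hM : 0 ≤ M := by
    have := (abs_nonneg _).trans (hG 0)
    simpa using this
  have hle : ∀ s, |G s| ≤ M * Real.exp s := fun s => (hG s).trans
    (mul_le_mul_of_nonneg_left (Real.exp_le_exp.2 (neg_abs_le s)) hM)
  have hle' : ∀ s, |G (-s)| ≤ M * Real.exp s := fun s => (hG (-s)).trans
    (mul_le_mul_of_nonneg_left (Real.exp_le_exp.2 (by
      rw [abs_neg]; exact neg_abs_le s)) hM)
  refine Summable.of_nat_of_neg ?_ ?_
  · refine (summable_lattice (Z := fun s => G (-s)) hd hle' (-t)).congr fun j => ?_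
    congr 1; push_cast; ring
  · refine (summable_lattice hd hle t).congr fun j => ?_
    congr 1; push_cast; ring

/-- The renewal theorem on a lattice. -/
theorem tendsto_sub_lattice_sum (hd : 0 < d) (hpq : p + q = 1)
    (hZe : ∀ t, |Z t| ≤ C * Real.exp t)
    (hG : ∀ t, |G t| ≤ M * Real.exp (-|t|))
    {m n : ℕ} (heq : ∀ t, Z t = G t + (p * Z (t - m * d) + q * Z (t - n * d)))
    (hper : d ∈ asymptoticPeriods Z) (hH : 0 < (p * m + q * n) * d) :
    Tendsto (fun t => Z t - d / ((p * m + q * n) * d) * ∑' j : ℤ, G (t + j * d)) atTop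
      (𝓝 0) := by
  have hM : 0 ≤ M := by
    have := (abs_nonneg _).trans (hG 0)
    simpa using this
  have hsZ := summable_lattice hd hZe
  have hGe : ∀ s, |G s| ≤ M * Real.exp s := fun s => (hG s).trans
    (mul_le_mul_of_nonneg_left (Real.exp_le_exp.2 (neg_abs_le s)) hM)
  have hsG := summable_lattice hd hGe
  have htel : ∀ (k : ℕ) (t : ℝ), ∑' j : ℕ, Z (t - j * d) =
      ∑ j ∈ Finset.range k, Z (t - j * d) + ∑' j : ℕ, Z (t - k * d - j * d) := by
    intro k t
    rw [← (hsZ t).sum_add_tsum_nat_add k]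
    congr 1
    refine tsum_congr fun j => ?_
    congr 1; push_cast; ring
  -- Lattice version of the integrated equation: summing along `t - j d` cancels all but the first
  -- `m` and `n` terms of the two shifted series.
  have hsum : ∀ t, ∑' j : ℕ, G (t - j * d) = p * (∑ j ∈ Finset.range m, Z (t - j * d)) +
      q * ∑ j ∈ Finset.range n, Z (t - j * d) := by
    intro t
    have h1 : ∑' j : ℕ, Z (t - j * d) = ∑' j : ℕ, G (t - j * d) +
        (p * ∑' j : ℕ, Z (t - m * d - j * d) + q * ∑' j : ℕ, Z (t - n * d - j * d)) := by
      rw [← tsum_mul_left, ← tsum_mul_left,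
        ← ((hsZ (t - m * d)).mul_left p).tsum_add ((hsZ (t - n * d)).mul_left q),
        ← (hsG t).tsum_add (((hsZ (t - m * d)).mul_left p).add ((hsZ (t - n * d)).mul_left q))]
      refine tsum_congr fun j => ?_
      rw [heq (t - j * d), sub_right_comm t (j * d) (m * d), sub_right_comm t (j * d) (n * d)]
    have h2 : ∑' j : ℕ, Z (t - j * d) = p * (∑' j : ℕ, Z (t - j * d)) +
        q * ∑' j : ℕ, Z (t - j * d) := by rw [← add_mul, hpq, one_mul]
    have h3 := congrArg (fun x => p * x) (htel m t)
    have h4 := congrArg (fun x => q * x) (htel n t)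
    simp only [mul_add] at h3 h4
    linarith
  have hfin : ∀ k : ℕ, Tendsto
      (fun t => k * Z t - ∑ j ∈ Finset.range k, Z (t - j * d)) atTop (𝓝 0) := by
    intro k
    have h1 : ∀ j : ℕ, Tendsto (fun t => Z t - Z (t - j * d)) atTop (𝓝 0) := by
      intro j
      have h2 : -((j : ℤ) • d) ∈ asymptoticPeriods Z := neg_mem (zsmul_mem hper _)
      simpa [sub_eq_add_neg] using mem_asymptoticPeriods.1 h2
    have h2 := tendsto_finsetSum (Finset.range k) fun j _ => h1 j
    simpa [Finset.sum_sub_distrib] using h2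
  -- The summation only reaches lattice points up to `t`; those beyond it lie where `G` is
  -- exponentially small.
  have hpos : Tendsto (fun t => ∑' j : ℕ, G (t + (j + 1 : ℕ) * d)) atTop (𝓝 0) := by
    have hs := (summable_nat_add_iff 1).2 (summable_exp_neg_nat_mul hd)
    have hbound : ∀ᶠ t : ℝ in atTop, ‖∑' j : ℕ, G (t + (j + 1 : ℕ) * d)‖ ≤
        (M * ∑' j : ℕ, Real.exp (-((j + 1 : ℕ) * d))) * Real.exp (-t) := by
      filter_upwards [eventually_ge_atTop 0] with t ht
      have : ∀ j : ℕ, ‖G (t + (j + 1 : ℕ) * d)‖ ≤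
          M * Real.exp (-t) * Real.exp (-((j + 1 : ℕ) * d)) := by
        intro j
        refine (hG _).trans (le_of_eq ?_)
        rw [abs_of_nonneg (by positivity), mul_assoc, ← Real.exp_add]
        congr 2
        ring
      refine (tsum_of_norm_bounded ((hs.mul_left (M * Real.exp (-t))).hasSum) this).trans
        (le_of_eq ?_)
      rw [tsum_mul_left]
      ring
    refine squeeze_zero_norm' hbound ?_
    simpa using (Real.tendsto_exp_neg_atTop_nhds_zero).const_mul
      (M * ∑' j : ℕ, Real.exp (-((j + 1 : ℕ) * d)))
  have hsplit : ∀ t, ∑' j : ℤ, G (t + j * d) =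
      ∑' j : ℕ, G (t + (j + 1 : ℕ) * d) + ∑' j : ℕ, G (t - j * d) := by
    intro t
    have hs := summable_int_lattice hd hG t
    have h1 := hs.comp_injective (i := fun j : ℕ => -(j : ℤ)) fun a b hab => by simpa using hab
    have h2 := hs.comp_injective (i := fun j : ℕ => ((j + 1 : ℕ) : ℤ)) fun a b hab => by
      simpa using hab
    rw [← (Equiv.neg ℤ).tsum_eq]
    rw [tsum_of_nat_of_neg_add_one]
    · rw [add_comm]
      congr 1
      · refine tsum_congr fun j => ?_
        simp [sub_eq_add_neg]
    · exact h1
    · exact h2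
  have h1 := (((hfin m).const_mul p).add ((hfin n).const_mul q)).sub hpos
  have h2 := h1.const_mul (d / ((p * m + q * n) * d))
  simp only [mul_zero, add_zero, sub_zero] at h2
  refine h2.congr fun t => ?_
  rw [hsplit t, hsum t]
  have hne : (p * m + q * n) ≠ 0 := fun h0 => by simp [h0] at hH
  field_simp
  ring

end RenewalLimit

/-! ### The occupancy function and its primitive -/

lemma integrable_exp_neg_mul_abs {c : ℝ} (hc : 0 < c) :
    Integrable fun t : ℝ => Real.exp (-(c * |t|)) := by
  rw [← integrableOn_univ, ← Set.Iic_union_Ioi (a := 0)]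
  refine IntegrableOn.union ?_ ?_
  · refine (integrableOn_exp_mul_Iic hc 0).congr_fun (fun t ht => ?_) measurableSet_Iic
    simp only
    rw [abs_of_nonpos ht]
    ring_nf
  · refine (integrableOn_exp_mul_Ioi (neg_lt_zero.2 hc) 0).congr_fun (fun t ht => ?_)
      measurableSet_Ioi
    simp only
    rw [abs_of_pos ht]
    ring_nf

lemma integrable_of_abs_le_exp {G : ℝ → ℝ} {M : ℝ} (hGc : Continuous G)
    (hG : ∀ t, |G t| ≤ M * Real.exp (-|t|)) : Integrable G :=
  Integrable.mono' (by simpa using (integrable_exp_neg_mul_abs one_pos).const_mul M)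
    hGc.aestronglyMeasurable (ae_of_all _ hG)

lemma tendsto_atTop_zero_of_abs_le_exp {G : ℝ → ℝ} {M : ℝ}
    (hG : ∀ t, |G t| ≤ M * Real.exp (-|t|)) : Tendsto G atTop (𝓝 0) := by
  refine squeeze_zero_norm hG ?_
  simpa using ((Real.tendsto_exp_neg_atTop_nhds_zero).comp tendsto_abs_atTop_atTop).const_mul M

/-- Integration with the substitution `x = exp t`. -/
lemma integral_Ioi_eq_integral_exp {E : Type*} [NormedAddCommGroup E] [NormedSpace ℝ E]
    (g : ℝ → E) : ∫ x in Set.Ioi (0 : ℝ), g x = ∫ t, Real.exp t • g (Real.exp t) := by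
  have h := integral_image_eq_integral_abs_deriv_smul (s := Set.univ) MeasurableSet.univ
    (fun x _ => (Real.hasDerivAt_exp x).hasDerivWithinAt) Real.exp_injective.injOn g
  rw [Set.image_univ, Real.range_exp] at h
  simpa [abs_of_pos (Real.exp_pos _)] using h

/-- The probability that a Poisson variable with mean `exp t` is positive. -/
def occupancy (t : ℝ) : ℝ := 1 - Real.exp (-Real.exp t)

/-- The derivative of `occupancy`. -/
def occupancyDeriv (t : ℝ) : ℝ := Real.exp t * Real.exp (-Real.exp t)

lemma hasDerivAt_occupancy (t : ℝ) : HasDerivAt occupancy (occupancyDeriv t) t := by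
  refine (((Real.hasDerivAt_exp t).neg.exp).const_sub 1).congr_deriv ?_
  simp only [occupancyDeriv, Pi.neg_apply]
  ring

lemma continuous_occupancy : Continuous occupancy := by unfold occupancy; fun_prop

lemma continuous_occupancyDeriv : Continuous occupancyDeriv := by unfold occupancyDeriv; fun_prop

lemma occupancy_nonneg (t : ℝ) : 0 ≤ occupancy t := by
  have : Real.exp (-Real.exp t) ≤ 1 := Real.exp_le_one_iff.2 (neg_nonpos.2 (Real.exp_pos t).le)
  unfold occupancy
  linarith

lemma occupancy_le_one (t : ℝ) : occupancy t ≤ 1 := by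
  unfold occupancy
  linarith [Real.exp_pos (-Real.exp t)]

lemma occupancy_le_exp (t : ℝ) : occupancy t ≤ Real.exp t := by
  unfold occupancy
  linarith [Real.add_one_le_exp (-Real.exp t)]

lemma one_sub_occupancy_le (t : ℝ) : 1 - occupancy t ≤ Real.exp (-t) := by
  unfold occupancy
  rw [sub_sub_cancel]
  exact Real.exp_le_exp.2 (by linarith [Real.add_one_le_exp t])

lemma occupancyDeriv_nonneg (t : ℝ) : 0 ≤ occupancyDeriv t := by
  unfold occupancyDeriv; positivity

/-- Polynomials times `exp (-z)`, where `z = exp t`, decay exponentially in both directions. -/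
lemma exp_pow_mul_exp_neg_exp_le (n : ℕ) (t : ℝ) :
    Real.exp t ^ (n + 1) * Real.exp (-Real.exp t) ≤ (n + 2).factorial * Real.exp (-|t|) := by
  have hz := Real.exp_pos t
  set z := Real.exp t with hzdef
  have hfac : (1 : ℝ) ≤ (n + 2).factorial := by exact_mod_cast Nat.succ_le_of_lt (Nat.factorial_pos _)
  rcases le_total 0 t with h | h
  · rw [abs_of_nonneg h, Real.exp_neg t, ← hzdef, Real.exp_neg z, ← div_eq_mul_inv,
      ← div_eq_mul_inv, div_le_div_iff₀ (Real.exp_pos z) hz]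
    -- For `z ≥ 1` one extra power of `z` is spent on the factor `1/z = exp(-|t|)`, which explains
    -- the factorial of `n + 2`.
    have := Real.pow_div_factorial_le_exp z hz.le (n + 2)
    rw [div_le_iff₀ (by positivity)] at this
    calc z ^ (n + 1) * z = z ^ (n + 2) := by ring
      _ ≤ _ := by rw [mul_comm]; exact this
  · rw [abs_of_nonpos h, neg_neg, ← hzdef]
    have h1 : z ≤ 1 := Real.exp_le_one_iff.2 h
    have h2 : z ^ (n + 1) ≤ z := by
      simpa using pow_le_pow_of_le_one hz.le h1 (Nat.le_add_left 1 n)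
    have h3 : Real.exp (-z) ≤ 1 := Real.exp_le_one_iff.2 (neg_nonpos.2 hz.le)
    calc z ^ (n + 1) * Real.exp (-z) ≤ z * 1 :=
          mul_le_mul h2 h3 (Real.exp_pos _).le hz.le
      _ ≤ (n + 2).factorial * z := by nlinarith

lemma occupancyDeriv_le (t : ℝ) : occupancyDeriv t ≤ 2 * Real.exp (-|t|) := by
  simpa [occupancyDeriv] using exp_pow_mul_exp_neg_exp_le 0 t

lemma abs_occupancyDeriv_le (t : ℝ) : |occupancyDeriv t| ≤ 2 * Real.exp (-|t|) := by
  rw [abs_of_nonneg (occupancyDeriv_nonneg t)]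
  exact occupancyDeriv_le t

/-- The primitive of `occupancy` that vanishes at `-∞`. -/
def occupancyPrimitive (t : ℝ) : ℝ := ∫ s in Set.Iic t, occupancy s

lemma abs_occupancy_le_exp (t : ℝ) : |occupancy t| ≤ 1 * Real.exp t := by
  rw [abs_of_nonneg (occupancy_nonneg t), one_mul]
  exact occupancy_le_exp t

lemma integrableOn_occupancy (t : ℝ) : IntegrableOn occupancy (Set.Iic t) :=
  integrableOn_Iic_of_le_exp continuous_occupancy abs_occupancy_le_exp t

lemma occupancyPrimitive_sub (a b : ℝ) :
    occupancyPrimitive b - occupancyPrimitive a = ∫ s in a..b, occupancy s :=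
  intervalIntegral.integral_Iic_sub_Iic (integrableOn_occupancy a) (integrableOn_occupancy b)

lemma hasDerivAt_occupancyPrimitive (t : ℝ) :
    HasDerivAt occupancyPrimitive (occupancy t) t := by
  have h := (intervalIntegral.integral_hasDerivAt_right
    (continuous_occupancy.intervalIntegrable 0 t)
    continuous_occupancy.aestronglyMeasurable.stronglyMeasurableAtFilter
    continuous_occupancy.continuousAt).add_const (occupancyPrimitive 0)
  refine h.congr_of_eventuallyEq (Eventually.of_forall fun s => ?_)
  simp only [← occupancyPrimitive_sub 0 s]
  ring

lemma continuous_occupancyPrimitive : Continuous occupancyPrimitive :=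
  continuous_iff_continuousAt.2 fun t => (hasDerivAt_occupancyPrimitive t).continuousAt

lemma occupancyPrimitive_nonneg (t : ℝ) : 0 ≤ occupancyPrimitive t :=
  setIntegral_nonneg measurableSet_Iic fun s _ => occupancy_nonneg s

lemma occupancyPrimitive_le_exp (t : ℝ) : occupancyPrimitive t ≤ Real.exp t := by
  rw [← integral_exp_Iic t]
  exact setIntegral_mono (integrableOn_occupancy t) (integrableOn_exp_Iic t) occupancy_le_exp

lemma monotone_occupancyPrimitive : Monotone occupancyPrimitive :=
  monotone_of_deriv_nonneg (fun t => (hasDerivAt_occupancyPrimitive t).differentiableAt)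
    fun t => by rw [(hasDerivAt_occupancyPrimitive t).deriv]; exact occupancy_nonneg t

lemma tendsto_occupancyPrimitive_atBot : Tendsto occupancyPrimitive atBot (𝓝 0) :=
  squeeze_zero occupancyPrimitive_nonneg occupancyPrimitive_le_exp Real.tendsto_exp_atBot

/-- With `x = exp t` this is the integral of `log x · exp(-x)` over the positive half-line, that is,
`Γ'(1)`. It is where Euler's constant enters. -/
lemma integral_mul_occupancyDeriv :
    ∫ t, t * occupancyDeriv t = -Real.eulerMascheroniConstant := by
  have h1 : HasDerivAt Complex.Gamma (∫ t in Set.Ioi (0 : ℝ),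
      (t : ℂ) ^ ((1 : ℂ) - 1) * (Real.log t * Real.exp (-t))) 1 := by
    refine (Complex.hasDerivAt_GammaIntegral (by simp)).congr_of_eventuallyEq ?_
    have : {s : ℂ | 0 < s.re} ∈ 𝓝 (1 : ℂ) :=
      (isOpen_lt continuous_const Complex.continuous_re).mem_nhds (by simp)
    filter_upwards [this] with s hs
    exact Complex.Gamma_eq_integral hs
  have h2 := h1.unique Complex.hasDerivAt_Gamma_one
  simp only [sub_self, Complex.cpow_zero, one_mul] at h2
  have h3 : ∫ t in Set.Ioi (0 : ℝ), Real.log t * Real.exp (-t) =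
      -Real.eulerMascheroniConstant := by
    apply Complex.ofReal_injective
    rw [← integral_complex_ofReal]
    push_cast at h2 ⊢
    exact h2
  rw [← h3, integral_Ioi_eq_integral_exp]
  refine integral_congr_ae (ae_of_all _ fun t => ?_)
  simp [occupancyDeriv]
  ring

lemma integrable_mul_occupancyDeriv : Integrable fun t => t * occupancyDeriv t := by
  refine Integrable.mono' ((integrable_exp_neg_mul_abs one_half_pos).const_mul 4)
    (continuous_id.mul continuous_occupancyDeriv).aestronglyMeasurable (ae_of_all _ fun t => ?_)
  rw [Real.norm_eq_abs, abs_mul]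
  -- Half of the exponential decay absorbs the linear factor.
  have h1 : |t| ≤ 2 * Real.exp (1 / 2 * |t|) := by
    have := Real.add_one_le_exp (1 / 2 * |t|)
    linarith
  calc |t| * |occupancyDeriv t| ≤ (2 * Real.exp (1 / 2 * |t|)) * (2 * Real.exp (-|t|)) :=
        mul_le_mul h1 (abs_occupancyDeriv_le t) (abs_nonneg _) (by positivity)
    _ = 4 * (Real.exp (1 / 2 * |t|) * Real.exp (-|t|)) := by ring
    _ = _ := by rw [← Real.exp_add]; ring_nf

/-- The primitive of `occupancy` is `t + γ + o(1)` as `t → ∞`. -/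
lemma tendsto_occupancyPrimitive_sub :
    Tendsto (fun t => occupancyPrimitive t - (t + Real.eulerMascheroniConstant)) atTop (𝓝 0) := by
  -- Integration by parts: the primitive is `t · occupancy t` minus the integral of `s ·
  -- occupancyDeriv s` over `(-∞, t]`, and that integral tends to `-γ`.
  have hderiv : ∀ t, HasDerivAt (fun t => t * occupancy t - occupancyPrimitive t)
      (t * occupancyDeriv t) t := by
    intro t
    refine (((hasDerivAt_id t).mul (hasDerivAt_occupancy t)).sub
      (hasDerivAt_occupancyPrimitive t)).congr_deriv ?_
    simp
  have hbot : Tendsto (fun t => t * occupancy t - occupancyPrimitive t) atBot (𝓝 0) := by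
    have h1 : Tendsto (fun t : ℝ => t * occupancy t) atBot (𝓝 0) := by
      have h2 : Tendsto (fun t : ℝ => t * Real.exp t) atBot (𝓝 0) := by
        have := ((Real.tendsto_pow_mul_exp_neg_atTop_nhds_zero 1).comp
          tendsto_neg_atBot_atTop).neg
        simpa [Function.comp_def] using this
      refine squeeze_zero_norm (a := fun t => ‖t * Real.exp t‖) (fun t => ?_) (by simpa using h2.norm)
      rw [norm_mul, norm_mul]
      refine mul_le_mul_of_nonneg_left ?_ (norm_nonneg _)
      rw [Real.norm_of_nonneg (occupancy_nonneg t), Real.norm_of_nonneg (Real.exp_pos t).le]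
      exact occupancy_le_exp t
    simpa using h1.sub tendsto_occupancyPrimitive_atBot
  have hI : ∀ t, ∫ s in Set.Iic t, s * occupancyDeriv s = t * occupancy t - occupancyPrimitive t :=
    fun t => by
      rw [integral_Iic_of_hasDerivAt_of_tendsto' (fun s _ => hderiv s)
        integrable_mul_occupancyDeriv.integrableOn hbot, sub_zero]
  have hlim : Tendsto (fun t => t * occupancy t - occupancyPrimitive t) atTop
      (𝓝 (-Real.eulerMascheroniConstant)) := by
    simp_rw [← hI, ← integral_mul_occupancyDeriv]
    exact (aecover_Iic tendsto_id).integral_tendsto_of_countably_generated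
      integrable_mul_occupancyDeriv
  have hone : Tendsto (fun t => t * (1 - occupancy t)) atTop (𝓝 0) := by
    refine squeeze_zero' ?_ ?_ (by simpa using Real.tendsto_pow_mul_exp_neg_atTop_nhds_zero 1)
    · filter_upwards [eventually_ge_atTop 0] with t ht
      exact mul_nonneg ht (sub_nonneg.2 (occupancy_le_one t))
    · filter_upwards [eventually_ge_atTop 0] with t ht
      exact mul_le_mul_of_nonneg_left (one_sub_occupancy_le t) ht
  have := (hlim.add hone).neg.sub_const Real.eulerMascheroniConstant
  simp only [add_zero, neg_neg, sub_self] at this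
  refine this.congr fun t => ?_
  ring

lemma occupancyPrimitive_sub_log_nonneg {c : ℝ} (hc1 : Real.log c ≤ 0) (t : ℝ) :
    0 ≤ occupancyPrimitive t - occupancyPrimitive (t + Real.log c) :=
  sub_nonneg.2 (monotone_occupancyPrimitive (by linarith))

lemma occupancyPrimitive_sub_log_le_exp (c t : ℝ) :
    occupancyPrimitive t - occupancyPrimitive (t + Real.log c) ≤ Real.exp t := by
  linarith [occupancyPrimitive_nonneg (t + Real.log c), occupancyPrimitive_le_exp t]

lemma occupancyPrimitive_sub_log_le {c : ℝ} (hc1 : Real.log c ≤ 0) (t : ℝ) :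
    occupancyPrimitive t - occupancyPrimitive (t + Real.log c) ≤ -Real.log c := by
  rw [occupancyPrimitive_sub]
  have := intervalIntegral.integral_mono_on (μ := volume) (a := t + Real.log c) (b := t)
    (by linarith) (continuous_occupancy.intervalIntegrable _ _)
    (continuous_const.intervalIntegrable _ _) fun s _ => occupancy_le_one s
  simpa using this

/-- On the window from `t + log c` to `t`, of length `-log c`, the occupancy falls short of `1` by
at most `exp(-s) ≤ exp(-t)/c`. -/
lemma le_occupancyPrimitive_sub_log {c : ℝ} (hc : 0 < c) (hc1 : Real.log c ≤ 0) (t : ℝ) :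
    -Real.log c - -Real.log c / c * Real.exp (-t) ≤
      occupancyPrimitive t - occupancyPrimitive (t + Real.log c) := by
  rw [occupancyPrimitive_sub]
  have := intervalIntegral.integral_mono_on (μ := volume) (a := t + Real.log c) (b := t)
    (f := fun _ => 1 - Real.exp (-t) / c) (g := occupancy)
    (by linarith) (continuous_const.intervalIntegrable _ _)
    (continuous_occupancy.intervalIntegrable _ _) fun s hs => by
      have h1 := one_sub_occupancy_le s
      have h2 : Real.exp (-s) ≤ Real.exp (-t) / c := by
        calc Real.exp (-s) ≤ Real.exp (-t - Real.log c) :=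
              Real.exp_le_exp.2 (by linarith [hs.1])
          _ = Real.exp (-t) / c := by rw [Real.exp_sub, Real.exp_log hc]
      linarith
  rw [intervalIntegral.integral_const, smul_eq_mul] at this
  refine le_trans (le_of_eq ?_) this
  ring

/-! ### Centering the occupancy function -/

/-- The mean of the negated increment of the random walk. -/
def walkMean (p q : ℝ) : ℝ := -(p * Real.log p + q * Real.log q)

/-- The part of `occupancy` that remains when the contribution of its primitive to the potential
is removed. -/
def centeredOccupancy (p q t : ℝ) : ℝ :=
  occupancy t - (occupancyPrimitive t - avg p q occupancyPrimitive t) / walkMean p q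

/-- The derivative of `centeredOccupancy`. -/
def centeredOccupancyDeriv (p q t : ℝ) : ℝ :=
  occupancyDeriv t - (occupancy t - avg p q occupancy t) / walkMean p q

section

variable {p q : ℝ}

lemma log_neg_left (hp : 0 < p) (hq : 0 < q) (hpq : p + q = 1) : Real.log p < 0 :=
  Real.log_neg hp (by linarith)

lemma log_neg_right (hp : 0 < p) (hq : 0 < q) (hpq : p + q = 1) : Real.log q < 0 :=
  Real.log_neg hq (by linarith)

lemma walkMean_pos (hp : 0 < p) (hq : 0 < q) (hpq : p + q = 1) : 0 < walkMean p q := by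
  have h1 := mul_neg_of_pos_of_neg hp (log_neg_left hp hq hpq)
  have h2 := mul_neg_of_pos_of_neg hq (log_neg_right hp hq hpq)
  unfold walkMean
  linarith

lemma sub_avg (hpq : p + q = 1) (G : ℝ → ℝ) (t : ℝ) :
    G t - avg p q G t = p * (G t - G (t + Real.log p)) + q * (G t - G (t + Real.log q)) := by
  have h : G t = p * G t + q * G t := by rw [← add_mul, hpq, one_mul]
  unfold avg
  linarith

lemma hasDerivAt_avg {G G' : ℝ → ℝ} (h : ∀ t, HasDerivAt G (G' t) t) (t : ℝ) :
    HasDerivAt (avg p q G) (avg p q G' t) t :=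
  (((h (t + Real.log p)).comp_add_const t (Real.log p)).const_mul p).add
    (((h (t + Real.log q)).comp_add_const t (Real.log q)).const_mul q)

lemma hasDerivAt_centeredOccupancy (t : ℝ) :
    HasDerivAt (centeredOccupancy p q) (centeredOccupancyDeriv p q t) t :=
  (hasDerivAt_occupancy t).sub (((hasDerivAt_occupancyPrimitive t).sub
    (hasDerivAt_avg hasDerivAt_occupancyPrimitive t)).div_const _)

lemma continuous_centeredOccupancy : Continuous (centeredOccupancy p q) :=
  continuous_iff_continuousAt.2 fun t => (hasDerivAt_centeredOccupancy t).continuousAt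

lemma continuous_avg {G : ℝ → ℝ} (h : Continuous G) : Continuous (avg p q G) := by
  unfold avg; fun_prop

lemma continuous_centeredOccupancyDeriv : Continuous (centeredOccupancyDeriv p q) :=
  continuous_occupancyDeriv.sub ((continuous_occupancy.sub
    (continuous_avg continuous_occupancy)).div_const _)

lemma occupancyPrimitive_sub_avg_nonneg (hp : 0 < p) (hq : 0 < q) (hpq : p + q = 1) (t : ℝ) :
    0 ≤ occupancyPrimitive t - avg p q occupancyPrimitive t := by
  rw [sub_avg hpq]
  exact add_nonneg
    (mul_nonneg hp.le (occupancyPrimitive_sub_log_nonneg (log_neg_left hp hq hpq).le t))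
    (mul_nonneg hq.le (occupancyPrimitive_sub_log_nonneg (log_neg_right hp hq hpq).le t))

/-- For `t ≤ 0` both terms are `O(exp t)`. For `t ≥ 0` both are `1 + O(exp(-t))`: the primitive has
slope nearly `1`, so one step of the walk lowers it on average by nearly `walkMean p q`, the
divisor. -/
lemma abs_centeredOccupancy_le (hp : 0 < p) (hq : 0 < q) (hpq : p + q = 1) :
    ∃ M, ∀ t, |centeredOccupancy p q t| ≤ M * Real.exp (-|t|) := by
  have hlp := log_neg_left hp hq hpq
  have hlq := log_neg_right hp hq hpq
  have hH := walkMean_pos hp hq hpq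
  set H := walkMean p q with hHdef
  refine ⟨1 + 1 / H + (-Real.log p - Real.log q) / H, fun t => ?_⟩
  have hE := Real.exp_pos (-|t|)
  set R := occupancyPrimitive t - avg p q occupancyPrimitive t with hR
  have hR0 : 0 ≤ R := occupancyPrimitive_sub_avg_nonneg hp hq hpq t
  have hR' := sub_avg hpq occupancyPrimitive t
  rw [← hR] at hR'
  have hc0 : 0 ≤ (-Real.log p - Real.log q) / H := by
    apply div_nonneg _ hH.le; linarith
  have hc1 : 0 ≤ 1 / H := by positivity
  rcases le_total t 0 with h | h
  · rw [abs_of_nonpos h, neg_neg] at hE ⊢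
    have hR1 : R ≤ Real.exp t := by
      rw [hR']
      have h1 := mul_le_mul_of_nonneg_left (occupancyPrimitive_sub_log_le_exp p t) hp.le
      have h2 := mul_le_mul_of_nonneg_left (occupancyPrimitive_sub_log_le_exp q t) hq.le
      calc _ ≤ p * Real.exp t + q * Real.exp t := add_le_add h1 h2
        _ = Real.exp t := by rw [← add_mul, hpq, one_mul]
    have h1 : R / H ≤ 1 / H * Real.exp t := by
      rw [div_mul_eq_mul_div, one_mul]; gcongr
    have h2 : 0 ≤ R / H := div_nonneg hR0 hH.le
    have h3 := occupancy_nonneg t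
    have h4 := occupancy_le_exp t
    have h5 := mul_nonneg hc0 hE.le
    have h6 := mul_nonneg hc1 hE.le
    unfold centeredOccupancy
    rw [abs_le]
    constructor <;> linarith
  · rw [abs_of_nonneg h] at hE ⊢
    have hR1 : R ≤ H := by
      rw [hR', hHdef, walkMean]
      have h1 := mul_le_mul_of_nonneg_left (occupancyPrimitive_sub_log_le hlp.le t) hp.le
      have h2 := mul_le_mul_of_nonneg_left (occupancyPrimitive_sub_log_le hlq.le t) hq.le
      linarith
    have hR2 : H - (-Real.log p - Real.log q) * Real.exp (-t) ≤ R := by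
      rw [hR', hHdef, walkMean]
      have h1 := mul_le_mul_of_nonneg_left (le_occupancyPrimitive_sub_log hp hlp.le t) hp.le
      have h2 := mul_le_mul_of_nonneg_left (le_occupancyPrimitive_sub_log hq hlq.le t) hq.le
      have e1 : p * (-Real.log p - -Real.log p / p * Real.exp (-t)) =
        -(p * Real.log p) - -Real.log p * Real.exp (-t) := by field_simp
      have e2 : q * (-Real.log q - -Real.log q / q * Real.exp (-t)) =
        -(q * Real.log q) - -Real.log q * Real.exp (-t) := by field_simp
      linarith
    have h1 : R / H ≤ 1 := (div_le_one hH).2 hR1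
    have h2 : 1 - (-Real.log p - Real.log q) / H * Real.exp (-t) ≤ R / H := by
      rw [le_div_iff₀ hH]
      refine le_trans (le_of_eq ?_) hR2
      field_simp
    have h3 := occupancy_le_one t
    have h4 := one_sub_occupancy_le t
    have h5 := mul_nonneg hc0 hE.le
    have h6 := mul_nonneg hc1 hE.le
    unfold centeredOccupancy
    rw [abs_le]
    constructor <;> linarith

/-- For `t ≥ 0` the shortfall of the occupancy at `t + log p` is at most `exp(-t)/p`, and its weight
`p` cancels the loss. The two letters together give the constant `2`. -/
lemma abs_occupancy_sub_avg_le (hp : 0 < p) (hq : 0 < q) (hpq : p + q = 1) (t : ℝ) :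
    |occupancy t - avg p q occupancy t| ≤ 2 * Real.exp (-|t|) := by
  have hmono : Monotone occupancy :=
    monotone_of_deriv_nonneg (fun t => (hasDerivAt_occupancy t).differentiableAt)
      fun t => by rw [(hasDerivAt_occupancy t).deriv]; exact occupancyDeriv_nonneg t
  have h0 : 0 ≤ occupancy t - avg p q occupancy t := by
    rw [sub_avg hpq]
    exact add_nonneg
      (mul_nonneg hp.le (sub_nonneg.2 (hmono (by linarith [log_neg_left hp hq hpq]))))
      (mul_nonneg hq.le (sub_nonneg.2 (hmono (by linarith [log_neg_right hp hq hpq]))))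
  rw [abs_of_nonneg h0]
  rcases le_total t 0 with h | h
  · rw [abs_of_nonpos h, neg_neg]
    have h1 : 0 ≤ avg p q occupancy t :=
      add_nonneg (mul_nonneg hp.le (occupancy_nonneg _)) (mul_nonneg hq.le (occupancy_nonneg _))
    linarith [occupancy_le_exp t, Real.exp_pos t]
  · rw [abs_of_nonneg h]
    have h1 := mul_le_mul_of_nonneg_left (one_sub_occupancy_le (t + Real.log p)) hp.le
    have h2 := mul_le_mul_of_nonneg_left (one_sub_occupancy_le (t + Real.log q)) hq.le
    have e1 : p * Real.exp (-(t + Real.log p)) = Real.exp (-t) := by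
      rw [neg_add, Real.exp_add, Real.exp_neg (Real.log p), Real.exp_log hp]
      field_simp
    have e2 : q * Real.exp (-(t + Real.log q)) = Real.exp (-t) := by
      rw [neg_add, Real.exp_add, Real.exp_neg (Real.log q), Real.exp_log hq]
      field_simp
    unfold avg
    linarith [occupancy_le_one t]

lemma abs_centeredOccupancyDeriv_le (hp : 0 < p) (hq : 0 < q) (hpq : p + q = 1) (t : ℝ) :
    |centeredOccupancyDeriv p q t| ≤ (2 + 2 / walkMean p q) * Real.exp (-|t|) := by
  have hH := walkMean_pos hp hq hpq
  have h1 := abs_occupancyDeriv_le t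
  have h2 : |(occupancy t - avg p q occupancy t) / walkMean p q| ≤
      2 / walkMean p q * Real.exp (-|t|) := by
    rw [abs_div, abs_of_pos hH, div_mul_eq_mul_div]
    gcongr
    exact abs_occupancy_sub_avg_le hp hq hpq t
  unfold centeredOccupancyDeriv
  refine (abs_sub _ _).trans ?_
  linarith

lemma integrable_centeredOccupancy (hp : 0 < p) (hq : 0 < q) (hpq : p + q = 1) :
    Integrable (centeredOccupancy p q) := by
  obtain ⟨M, hM⟩ := abs_centeredOccupancy_le hp hq hpq
  exact integrable_of_abs_le_exp continuous_centeredOccupancy hM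

lemma hasDerivAt_integral_occupancyPrimitive (u t : ℝ) :
    HasDerivAt (fun t => ∫ s in u..0, occupancyPrimitive (t + s))
      (occupancyPrimitive t - occupancyPrimitive (t + u)) t := by
  have hc := continuous_occupancyPrimitive
  have hF : ∀ x, HasDerivAt (fun x => ∫ s in (0 : ℝ)..x, occupancyPrimitive s)
      (occupancyPrimitive x) x := fun x =>
    intervalIntegral.integral_hasDerivAt_right (hc.intervalIntegrable 0 x)
      hc.aestronglyMeasurable.stronglyMeasurableAtFilter hc.continuousAt
  refine ((hF t).sub ((hF (t + u)).comp_add_const t u)).congr_of_eventuallyEq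
    (Eventually.of_forall fun x => ?_)
  simp only [Pi.sub_apply]
  rw [intervalIntegral.integral_comp_add_left, add_zero,
    intervalIntegral.integral_interval_sub_left (hc.intervalIntegrable _ _)
      (hc.intervalIntegrable _ _)]

lemma tendsto_integral_occupancyPrimitive_atBot {u : ℝ} (hu : u ≤ 0) :
    Tendsto (fun t => ∫ s in u..0, occupancyPrimitive (t + s)) atBot (𝓝 0) := by
  have hc := continuous_occupancyPrimitive
  refine squeeze_zero (g := fun t => -u * Real.exp t) (fun t => ?_) (fun t => ?_) ?_
  · exact intervalIntegral.integral_nonneg hu fun s _ => occupancyPrimitive_nonneg _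
  · have := intervalIntegral.integral_mono_on (μ := volume) hu
      (f := fun s => occupancyPrimitive (t + s)) (g := fun _ => Real.exp t)
      ((by fun_prop : Continuous fun s => occupancyPrimitive (t + s)).intervalIntegrable _ _)
      (continuous_const.intervalIntegrable _ _) fun s hs =>
        (occupancyPrimitive_le_exp _).trans (Real.exp_le_exp.2 (by linarith [hs.2]))
    simpa using this
  · simpa using Real.tendsto_exp_atBot.const_mul (-u)

lemma tendsto_integral_occupancyPrimitive_atTop {u : ℝ} :
    Tendsto (fun t => (∫ s in u..0, occupancyPrimitive (t + s)) -
      (-u * (t + Real.eulerMascheroniConstant) - u ^ 2 / 2)) atTop (𝓝 0) := by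
  have hc := continuous_occupancyPrimitive
  set ε : ℝ → ℝ := fun t => occupancyPrimitive t - (t + Real.eulerMascheroniConstant) with hε
  have hεc : Continuous ε := by fun_prop
  have hε0 : Tendsto ε atTop (𝓝 0) := tendsto_occupancyPrimitive_sub
  have hint : ∀ t, ∫ s in u..0, ε (t + s) = (∫ s in u..0, occupancyPrimitive (t + s)) -
      (-u * (t + Real.eulerMascheroniConstant) - u ^ 2 / 2) := by
    intro t
    simp only [hε]
    rw [intervalIntegral.integral_sub]
    · congr 1
      have : (fun s => t + s + Real.eulerMascheroniConstant) =
          fun s => (t + Real.eulerMascheroniConstant) + s := by ext s; ring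
      rw [this, intervalIntegral.integral_add (by simp) (by simp)]
      simp
      ring
    · exact (by fun_prop : Continuous fun s => occupancyPrimitive (t + s)).intervalIntegrable _ _
    · exact (by fun_prop :
        Continuous fun s => t + s + Real.eulerMascheroniConstant).intervalIntegrable _ _
  simp_rw [← hint]
  -- Once `t ≥ T + |u|`, the whole window lies beyond `T`, where `|ε| < 1`; hence the dominating
  -- constant `1`.
  obtain ⟨T, hT⟩ := eventually_atTop.1 (hε0.eventually (Metric.ball_mem_nhds 0 one_pos))
  have := intervalIntegral.tendsto_integral_filter_of_dominated_convergence (μ := volume)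
    (l := (atTop : Filter ℝ)) (a := u) (b := 0) (F := fun t s => ε (t + s))
    (f := fun _ => 0) (fun _ => 1)
    (Eventually.of_forall fun t =>
      (by fun_prop : Continuous fun s => ε (t + s)).aestronglyMeasurable) ?_ (by simp)
    (ae_of_all _ fun s _ => hε0.comp (tendsto_atTop_add_const_right atTop s tendsto_id))
  · simpa using this
  · filter_upwards [eventually_ge_atTop (T + |u|)] with t ht
    refine ae_of_all _ fun s hs => ?_
    have h1 : |0 - s| ≤ |0 - u| :=
      Set.abs_sub_right_of_mem_uIcc (Set.uIoc_subset_uIcc hs)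
    have h2 := hT (t + s) (by
      simp only [zero_sub, abs_neg] at h1
      linarith [neg_abs_le s])
    rw [dist_zero_right] at h2
    exact h2.le

/-- An antiderivative is the primitive minus its own averages over windows of lengths `-log p` and
`-log q`. At `+∞` a window integral is `-u(t + γ) - u²/2 + o(1)`: the linear parts cancel by the
choice of `walkMean`, and the quadratic ones leave the second moment. -/
lemma integral_centeredOccupancy (hp : 0 < p) (hq : 0 < q) (hpq : p + q = 1) :
    ∫ t, centeredOccupancy p q t = entropySecondMoment p q / (2 * walkMean p q) := by
  have hH := walkMean_pos hp hq hpq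
  set H := walkMean p q with hHdef
  set J : ℝ → ℝ → ℝ := fun u t => ∫ s in u..0, occupancyPrimitive (t + s) with hJ
  set Φ : ℝ → ℝ := fun t => occupancyPrimitive t -
    (p * J (Real.log p) t + q * J (Real.log q) t) / H with hΦ
  have hderiv : ∀ t, HasDerivAt Φ (centeredOccupancy p q t) t := by
    intro t
    refine ((hasDerivAt_occupancyPrimitive t).sub
      ((((hasDerivAt_integral_occupancyPrimitive (Real.log p) t).const_mul p).add
      ((hasDerivAt_integral_occupancyPrimitive (Real.log q) t).const_mul q)).div_const H)).congr_deriv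
      ?_
    rw [centeredOccupancy, sub_avg hpq]
  have hbot : Tendsto Φ atBot (𝓝 0) := by
    have := tendsto_occupancyPrimitive_atBot.sub
      ((((tendsto_integral_occupancyPrimitive_atBot
        (log_neg_left hp hq hpq).le).const_mul p).add
      ((tendsto_integral_occupancyPrimitive_atBot
        (log_neg_right hp hq hpq).le).const_mul q)).div_const H)
    simp only [mul_zero, add_zero, zero_div, sub_zero] at this
    exact this
  have htop : Tendsto Φ atTop (𝓝 (entropySecondMoment p q / (2 * H))) := by
    have := (tendsto_occupancyPrimitive_sub.sub
      ((((tendsto_integral_occupancyPrimitive_atTop (u := Real.log p)).const_mul p).add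
      ((tendsto_integral_occupancyPrimitive_atTop (u := Real.log q)).const_mul q)).div_const
        H)).add_const (entropySecondMoment p q / (2 * H))
    simp only [mul_zero, add_zero, zero_div, sub_zero, zero_add] at this
    refine this.congr fun t => ?_
    simp only [hΦ, hJ, entropySecondMoment]
    field_simp
    rw [hHdef, walkMean]
    ring
  rw [integral_of_hasDerivAt_of_tendsto hderiv (integrable_centeredOccupancy hp hq hpq) hbot htop,
    sub_zero]

/-- The exponential is an eigenfunction of the averaging operator with eigenvalue `p² + q² < 1`, and
it dominates the primitive. -/
lemma tendsto_iterate_avg_occupancyPrimitive (hp : 0 < p) (hq : 0 < q) (hpq : p + q = 1) (t : ℝ) :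
    Tendsto (fun k => (avg p q)^[k] occupancyPrimitive t) atTop (𝓝 0) := by
  have hexp : ∀ k, (avg p q)^[k] Real.exp t = (p ^ 2 + q ^ 2) ^ k * Real.exp t := by
    intro k
    induction k generalizing t with
    | zero => simp
    | succ k ih =>
      rw [Function.iterate_succ_apply', avg, ih, ih, Real.exp_add, Real.exp_add,
        Real.exp_log hp, Real.exp_log hq]
      ring
  refine squeeze_zero (fun k => ?_) (fun k => (iterate_avg_mono hp hq
    occupancyPrimitive_le_exp k t).trans (hexp k).le) ?_
  · rw [iterate_avg_eq_sum hp hq]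
    exact Finset.sum_nonneg fun w _ =>
      mul_nonneg (wordProb_pos hp hq w).le (occupancyPrimitive_nonneg _)
  · have := (tendsto_pow_atTop_nhds_zero_of_lt_one (r := p ^ 2 + q ^ 2) (by positivity)
      (by nlinarith [mul_pos hp hq])).mul_const (Real.exp t)
    simpa using this

/-- The occupancy is not small at `+∞`, so its potential is not covered by the decay bounds. It
splits into a coboundary, which telescopes to the primitive, and the centered part. -/
lemma hasSum_iterate_avg_occupancy (hp : 0 < p) (hq : 0 < q) (hpq : p + q = 1) (t : ℝ) :
    HasSum (fun k => (avg p q)^[k] occupancy t)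
      (occupancyPrimitive t / walkMean p q + potential p q (centeredOccupancy p q) t) := by
  have hH := walkMean_pos hp hq hpq
  obtain ⟨M, hM⟩ := abs_centeredOccupancy_le hp hq hpq
  have h1 := (summable_iterate_avg hp hq hpq hM t).hasSum
  have h2 : HasSum (fun k => (avg p q)^[k] occupancyPrimitive t -
      (avg p q)^[k + 1] occupancyPrimitive t) (occupancyPrimitive t) := by
    rw [hasSum_iff_tendsto_nat_of_nonneg]
    · simp_rw [Finset.sum_range_sub']
      simpa using (tendsto_iterate_avg_occupancyPrimitive hp hq hpq t).const_sub
        (occupancyPrimitive t)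
    · intro k
      rw [Function.iterate_succ_apply, ← iterate_avg_sub hp hq, iterate_avg_eq_sum hp hq]
      exact Finset.sum_nonneg fun w _ => mul_nonneg (wordProb_pos hp hq w).le
        (occupancyPrimitive_sub_avg_nonneg hp hq hpq _)
  have heq : ∀ k, (avg p q)^[k] occupancy t =
      ((avg p q)^[k] occupancyPrimitive t - (avg p q)^[k + 1] occupancyPrimitive t) /
        walkMean p q + (avg p q)^[k] (centeredOccupancy p q) t := by
    intro k
    rw [Function.iterate_succ_apply, ← iterate_avg_sub hp hq, div_eq_inv_mul,
      ← iterate_avg_const_mul hp hq, ← iterate_avg_add hp hq]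
    exact congrArg (fun G => (avg p q)^[k] G t) (funext fun s => by
      rw [centeredOccupancy]; ring)
  simp_rw [heq]
  exact (h2.div_const _).add h1

end

/-! ### Fourier transforms and the Gamma function -/

/-- The integral of `f` against the character of frequency `ω`. -/
def charIntegral (ω : ℝ) (f : ℝ → ℝ) : ℂ := ∫ t, (f t : ℂ) * Complex.exp (-(Complex.I * ω * t))

lemma norm_exp_neg_I_mul (ω t : ℝ) : ‖Complex.exp (-(Complex.I * ω * t))‖ = 1 := by
  rw [show -(Complex.I * ω * t) = ((-(ω * t) : ℝ) : ℂ) * Complex.I by push_cast; ring,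
    Complex.norm_exp_ofReal_mul_I]

lemma integrable_mul_char {f : ℝ → ℝ} (hf : Integrable f) (ω : ℝ) :
    Integrable fun t => (f t : ℂ) * Complex.exp (-(Complex.I * ω * t)) := by
  have hfC : Integrable fun t => (f t : ℂ) := hf.ofReal
  refine Integrable.mono hfC (hfC.1.mul
    (by fun_prop : Continuous fun t : ℝ =>
      Complex.exp (-(Complex.I * ω * t))).aestronglyMeasurable) (ae_of_all _ fun t => ?_)
  rw [norm_mul, norm_exp_neg_I_mul, mul_one]

lemma charIntegral_sub {f g : ℝ → ℝ} (hf : Integrable f) (hg : Integrable g) (ω : ℝ) :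
    charIntegral ω (fun t => f t - g t) = charIntegral ω f - charIntegral ω g := by
  rw [charIntegral, charIntegral, charIntegral,
    ← integral_sub (integrable_mul_char hf ω) (integrable_mul_char hg ω)]
  simp only [Complex.ofReal_sub, sub_mul]

lemma charIntegral_add {f g : ℝ → ℝ} (hf : Integrable f) (hg : Integrable g) (ω : ℝ) :
    charIntegral ω (fun t => f t + g t) = charIntegral ω f + charIntegral ω g := by
  rw [charIntegral, charIntegral, charIntegral,
    ← integral_add (integrable_mul_char hf ω) (integrable_mul_char hg ω)]
  simp only [Complex.ofReal_add, add_mul]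

lemma charIntegral_const_mul (c : ℝ) (f : ℝ → ℝ) (ω : ℝ) :
    charIntegral ω (fun t => c * f t) = c * charIntegral ω f := by
  rw [charIntegral, charIntegral, ← integral_const_mul]
  simp only [Complex.ofReal_mul, mul_assoc]

lemma charIntegral_shift (f : ℝ → ℝ) (ω u : ℝ) :
    charIntegral ω (fun t => f (t + u)) = Complex.exp (Complex.I * ω * u) * charIntegral ω f := by
  rw [charIntegral, charIntegral, ← integral_const_mul,
    ← integral_add_right_eq_self (fun t : ℝ => Complex.exp (Complex.I * ω * u) *
      ((f t : ℂ) * Complex.exp (-(Complex.I * ω * t)))) u]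
  refine integral_congr_ae (ae_of_all _ fun t => ?_)
  simp only
  rw [mul_left_comm, ← Complex.exp_add]
  congr 2
  push_cast
  ring

lemma charIntegral_deriv {f f' : ℝ → ℝ} (hf : Integrable f) (hf' : Integrable f')
    (h : ∀ t, HasDerivAt f (f' t) t) (ω : ℝ) :
    charIntegral ω f' = Complex.I * ω * charIntegral ω f := by
  have hv : ∀ t : ℝ, HasDerivAt (fun t : ℝ => Complex.exp (-(Complex.I * ω * t)))
      (Complex.exp (-(Complex.I * ω * t)) * -(Complex.I * ω)) t := by
    intro t
    have h1 : HasDerivAt (fun z : ℂ => -(Complex.I * ω * z)) (-(Complex.I * ω)) (t : ℂ) :=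
      (((hasDerivAt_id (t : ℂ)).const_mul (Complex.I * ω)).neg).congr_deriv (by simp)
    exact h1.cexp.comp_ofReal
  have hi := integrable_mul_char hf ω
  have key := integral_mul_deriv_eq_deriv_mul_of_integrable
    (u := fun t => (f t : ℂ)) (u' := fun t => (f' t : ℂ))
    (fun t _ => (h t).ofReal_comp) (fun t _ => hv t)
    (by simpa only [Pi.mul_def, ← mul_assoc] using hi.mul_const (-(Complex.I * ω)))
    (integrable_mul_char hf' ω) hi
  simp only [← mul_assoc] at key
  rw [integral_mul_const] at key
  rw [charIntegral, charIntegral]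
  linear_combination key

lemma charIntegral_occupancyDeriv (ω : ℝ) :
    charIntegral ω occupancyDeriv = Complex.Gamma (1 - Complex.I * ω) := by
  rw [Complex.Gamma_eq_integral (by simp), Complex.GammaIntegral, integral_Ioi_eq_integral_exp,
    charIntegral]
  refine integral_congr_ae (ae_of_all _ fun t => ?_)
  have hne : ((Real.exp t : ℝ) : ℂ) ≠ 0 := by
    exact_mod_cast (Real.exp_pos t).ne'
  simp only [occupancyDeriv]
  rw [Complex.cpow_def_of_ne_zero hne, ← Complex.ofReal_log (Real.exp_pos t).le, Real.log_exp,
    show (t : ℂ) * (1 - Complex.I * ω - 1) = -(Complex.I * ω * t) by ring, Complex.real_smul]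
  push_cast
  ring

section

variable {p q : ℝ}

/-- At a frequency for which both letter shifts act trivially, averaging does not change the
transform, so the centering term drops out. As `occupancy` itself is not integrable, the argument
goes through derivatives: the transform of `g'` is `Γ(1 - iω)`, and the functional equation divides
it by `iω`. -/
lemma charIntegral_centeredOccupancy (hp : 0 < p) (hq : 0 < q) (hpq : p + q = 1) {ω : ℝ}
    (hω : ω ≠ 0) (h1 : Complex.exp (Complex.I * ω * Real.log p) = 1)
    (h2 : Complex.exp (Complex.I * ω * Real.log q) = 1) :
    charIntegral ω (centeredOccupancy p q) = -Complex.Gamma (-(Complex.I * ω)) := by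
  have hI : Complex.I * ω ≠ 0 := mul_ne_zero Complex.I_ne_zero (by exact_mod_cast hω)
  have hFi : Integrable occupancyDeriv :=
    integrable_of_abs_le_exp continuous_occupancyDeriv abs_occupancyDeriv_le
  have havg : Integrable (avg p q occupancyDeriv) :=
    ((hFi.comp_add_right (Real.log p)).const_mul p).add
      ((hFi.comp_add_right (Real.log q)).const_mul q)
  have hdi : Integrable fun t => occupancy t - avg p q occupancy t :=
    integrable_of_abs_le_exp (continuous_occupancy.sub (continuous_avg continuous_occupancy))
      (abs_occupancy_sub_avg_le hp hq hpq)
  have hzero : charIntegral ω (fun t => occupancy t - avg p q occupancy t) = 0 := by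
    have hd := charIntegral_deriv hdi (hFi.sub havg)
      (fun t => (hasDerivAt_occupancy t).sub (hasDerivAt_avg hasDerivAt_occupancy t)) ω
    have hself : charIntegral ω (avg p q occupancyDeriv) = charIntegral ω occupancyDeriv := by
      unfold avg
      rw [charIntegral_add ((hFi.comp_add_right _).const_mul p)
        ((hFi.comp_add_right _).const_mul q), charIntegral_const_mul, charIntegral_const_mul,
        charIntegral_shift, charIntegral_shift, h1, h2, one_mul, ← add_mul]
      rw [← Complex.ofReal_add, hpq, Complex.ofReal_one, one_mul]
    have hs : charIntegral ω (occupancyDeriv - avg p q occupancyDeriv) = 0 := by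
      have := charIntegral_sub hFi havg ω
      rw [hself, sub_self] at this
      exact this
    rw [hs] at hd
    exact (mul_eq_zero.1 hd.symm).resolve_left hI
  have hderivInt : Integrable (centeredOccupancyDeriv p q) :=
    integrable_of_abs_le_exp continuous_centeredOccupancyDeriv
      (abs_centeredOccupancyDeriv_le hp hq hpq)
  have hd := charIntegral_deriv (integrable_centeredOccupancy hp hq hpq) hderivInt
    hasDerivAt_centeredOccupancy ω
  have hG : charIntegral ω (centeredOccupancyDeriv p q) = Complex.Gamma (1 - Complex.I * ω) := by
    have : centeredOccupancyDeriv p q = fun t => occupancyDeriv t -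
        (walkMean p q)⁻¹ * (occupancy t - avg p q occupancy t) := by
      ext t
      rw [centeredOccupancyDeriv]
      ring
    rw [this, charIntegral_sub hFi (hdi.const_mul _), charIntegral_const_mul, hzero, mul_zero,
      sub_zero, charIntegral_occupancyDeriv]
  rw [hG] at hd
  have hrec := Complex.Gamma_add_one (-(Complex.I * ω)) (neg_ne_zero.2 hI)
  rw [neg_add_eq_sub, hd] at hrec
  apply mul_left_cancel₀ hI
  linear_combination hrec

end

lemma norm_Gamma_le_Gamma_re {s : ℂ} (hs : 0 < s.re) : ‖Complex.Gamma s‖ ≤ Real.Gamma s.re := by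
  rw [Complex.Gamma_eq_integral hs, Complex.GammaIntegral, Real.Gamma_eq_integral hs]
  refine (norm_integral_le_integral_norm _).trans_eq
    (setIntegral_congr_fun measurableSet_Ioi fun x hx => ?_)
  rw [norm_mul, Complex.norm_cpow_eq_rpow_re_of_pos hx, Complex.norm_real,
    Real.norm_of_nonneg (Real.exp_pos _).le]
  simp

/-- Two steps of the functional equation lead from `-iω` to `2 - iω`, where the modulus is at most
`Γ(2) = 1`; each of the two factors has modulus at least `|ω|`. Quadratic decay suffices for
absolute convergence of the Fourier series. -/
lemma norm_Gamma_neg_I_mul_le (ω : ℝ) : ‖Complex.Gamma (-(Complex.I * ω))‖ ≤ 1 / ω ^ 2 := by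
  rcases eq_or_ne ω 0 with rfl | hω
  -- At frequency zero both sides are `0`: the value of `Complex.Gamma` at its pole and the inverse
  -- of zero are both `0` by convention.
  · simp
  have hI : -(Complex.I * ω) ≠ 0 :=
    neg_ne_zero.2 (mul_ne_zero Complex.I_ne_zero (by exact_mod_cast hω))
  have hI1 : -(Complex.I * ω) + 1 ≠ 0 := fun h => by
    have := congrArg Complex.re h
    simp at this
  have h1 := Complex.Gamma_add_one _ hI
  have h2 := Complex.Gamma_add_one _ hI1
  rw [h1, ← mul_assoc] at h2
  have h3 : ‖Complex.Gamma (-(Complex.I * ω) + 1 + 1)‖ ≤ 1 := by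
    refine (norm_Gamma_le_Gamma_re (by simp)).trans_eq ?_
    have : (-(Complex.I * ω) + 1 + 1 : ℂ).re = 2 := by simp; norm_num
    rw [this, Real.Gamma_two]
  rw [h2, norm_mul, norm_mul] at h3
  have h4 : ‖-(Complex.I * (ω : ℂ))‖ = |ω| := by simp
  have h5 : |ω| ≤ ‖-(Complex.I * (ω : ℂ)) + 1‖ := by
    refine le_trans (le_of_eq ?_) (Complex.abs_im_le_norm _)
    simp
  rw [h4] at h3
  rw [le_div_iff₀ (by positivity), ← sq_abs, sq]
  have h6 : |ω| * |ω| ≤ ‖-(Complex.I * (ω : ℂ)) + 1‖ * |ω| :=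
    mul_le_mul_of_nonneg_right h5 (abs_nonneg _)
  nlinarith [norm_nonneg (Complex.Gamma (-(Complex.I * ω)))]

/-! ### Poisson summation on the lattice -/

section Lattice

variable {p q d : ℝ}

/-- The terms of the Fourier series of the oscillation. -/
def oscillationTerm (H d : ℝ) (k : ℤ) (t : ℝ) : ℂ :=
  -(1 / (H : ℂ)) * (Complex.Gamma (-2 * Real.pi * Complex.I * k / d) *
    Complex.exp (2 * Real.pi * Complex.I * k * t / d))

lemma norm_oscillationTerm_le {H : ℝ} (hH : 0 < H) (hd : 0 < d) (k : ℤ) (t : ℝ) :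
    ‖oscillationTerm H d k t‖ ≤ d ^ 2 / (4 * Real.pi ^ 2 * H) * (1 / (k : ℝ) ^ 2) := by
  have e1 : -2 * Real.pi * Complex.I * k / d =
      -(Complex.I * ((2 * Real.pi * k / d : ℝ) : ℂ)) := by push_cast; ring
  have e2 : 2 * Real.pi * Complex.I * k * t / d =
      ((2 * Real.pi * k * t / d : ℝ) : ℂ) * Complex.I := by push_cast; ring
  rw [oscillationTerm, norm_mul, norm_mul, e1, e2, Complex.norm_exp_ofReal_mul_I, mul_one]
  have h1 := norm_Gamma_neg_I_mul_le (2 * Real.pi * k / d)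
  have h2 : ‖-(1 / (H : ℂ))‖ = 1 / H := by
    rw [norm_neg, norm_div, norm_one, Complex.norm_real, Real.norm_of_nonneg hH.le]
  rw [h2]
  calc _ ≤ 1 / H * (1 / (2 * Real.pi * k / d) ^ 2) := by gcongr
    _ = _ := by
      rcases eq_or_ne k 0 with rfl | hk
      · simp
      · have : (k : ℝ) ≠ 0 := by exact_mod_cast hk
        field_simp
        norm_num

lemma continuous_oscillationTerm (H d : ℝ) (k : ℤ) : Continuous (oscillationTerm H d k) := by
  unfold oscillationTerm; fun_prop

lemma exp_frequency_mul_eq_one (hd : d ≠ 0) {x : ℝ} {m : ℤ} (hx : x = m * d) (k : ℤ) :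
    Complex.exp (Complex.I * ((2 * Real.pi * k / d : ℝ) : ℂ) * x) = 1 := by
  rw [Complex.exp_eq_one_iff]
  refine ⟨k * m, ?_⟩
  rw [hx]
  have : (d : ℂ) ≠ 0 := by exact_mod_cast hd
  push_cast
  field_simp

open FourierTransform in
/-- Poisson summation for the lattice sum of the centered occupancy. -/
theorem hasSum_oscillationTerm (hp : 0 < p) (hq : 0 < q) (hpq : p + q = 1) (hd : 0 < d)
    {m n : ℤ} (hm : Real.log p = m * d) (hn : Real.log q = n * d) (t : ℝ) :
    HasSum (fun k => oscillationTerm (walkMean p q) d k t)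
      ((d / walkMean p q * ∑' j : ℤ, centeredOccupancy p q (t + j * d) -
        entropySecondMoment p q / (2 * walkMean p q ^ 2) : ℝ) : ℂ) := by
  have hH := walkMean_pos hp hq hpq
  set H := walkMean p q with hHdef
  obtain ⟨M, hM⟩ := abs_centeredOccupancy_le hp hq hpq
  have hM0 : 0 ≤ M := by
    have := (abs_nonneg _).trans (hM 0)
    simpa using this
  -- Rescaling by `d` turns the lattice `dℤ` into `ℤ`; the Fourier coefficient at `k` becomes the
  -- transform at frequency `2πk/d`, divided by `d`.
  set f : ℝ → ℂ := fun x => (centeredOccupancy p q (x * d) : ℂ) with hf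
  have hfc : Continuous f := Complex.continuous_ofReal.comp
    (continuous_centeredOccupancy.comp (continuous_id.mul continuous_const))
  have hfour : ∀ k : ℤ, 𝓕 f k = 1 / d * charIntegral (2 * Real.pi * k / d)
      (centeredOccupancy p q) := by
    intro k
    rw [Real.fourier_real_eq_integral_exp_smul, charIntegral]
    have h1 := Measure.integral_comp_mul_right (fun s : ℝ => (centeredOccupancy p q s : ℂ) *
      Complex.exp (-(Complex.I * ((2 * Real.pi * k / d : ℝ) : ℂ) * s))) d
    rw [abs_of_pos (inv_pos.2 hd), Complex.real_smul, Complex.ofReal_inv, ← one_div] at h1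
    rw [← h1]
    refine integral_congr_ae (ae_of_all _ fun v => ?_)
    simp only [hf, smul_eq_mul]
    rw [mul_comm]
    congr 2
    have : (d : ℂ) ≠ 0 := by exact_mod_cast hd.ne'
    push_cast
    field_simp
  have hfour0 : 𝓕 f ((0 : ℤ) : ℝ) = (1 / d * (entropySecondMoment p q / (2 * H)) : ℝ) := by
    rw [hfour 0, charIntegral]
    simp only [Int.cast_zero, mul_zero, zero_div, Complex.ofReal_zero, zero_mul, neg_zero,
      Complex.exp_zero, mul_one]
    rw [integral_complex_ofReal, integral_centeredOccupancy hp hq hpq]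
    push_cast
    ring
  -- `oscillationTerm` vanishes at `k = 0` because `Complex.Gamma 0 = 0`, so the mean of the lattice
  -- sum is carried by the separate indicator term.
  have hterm : ∀ k : ℤ, (d / H : ℂ) * (𝓕 f k * fourier k ((t / d : ℝ) : UnitAddCircle)) =
      oscillationTerm H d k t +
        if k = 0 then ((entropySecondMoment p q / (2 * H ^ 2) : ℝ) : ℂ) else 0 := by
    intro k
    have hdC : (d : ℂ) ≠ 0 := by exact_mod_cast hd.ne'
    have hHC : (H : ℂ) ≠ 0 := by exact_mod_cast hH.ne'
    rw [fourier_coe_apply]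
    split_ifs with hk
    · subst hk
      rw [hfour0]
      simp only [oscillationTerm, Int.cast_zero, mul_zero, zero_mul, zero_div, Complex.exp_zero,
        Complex.Gamma_zero]
      push_cast
      field_simp
      ring
    · rw [hfour k, charIntegral_centeredOccupancy hp hq hpq]
      · rw [oscillationTerm, show -2 * Real.pi * Complex.I * k / d =
          -(Complex.I * ((2 * Real.pi * k / d : ℝ) : ℂ)) by push_cast; ring,
          show 2 * Real.pi * Complex.I * k * ((t / d : ℝ) : ℂ) / ((1 : ℝ) : ℂ) =
            2 * Real.pi * Complex.I * k * t / d by push_cast; ring]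
        field_simp
        ring
      · have : (k : ℝ) ≠ 0 := by exact_mod_cast hk
        have := Real.pi_pos
        positivity
      · exact exp_frequency_mul_eq_one hd.ne' hm k
      · exact exp_frequency_mul_eq_one hd.ne' hn k
  have hosum : Summable fun k : ℤ => oscillationTerm H d k t :=
    Summable.of_norm_bounded ((Real.summable_one_div_int_pow.2 one_lt_two).mul_left _)
      fun k => norm_oscillationTerm_le hH hd k t
  have hconst : HasSum (fun k : ℤ =>
      if k = 0 then ((entropySecondMoment p q / (2 * H ^ 2) : ℝ) : ℂ) else 0)
      ((entropySecondMoment p q / (2 * H ^ 2) : ℝ) : ℂ) := hasSum_ite_eq 0 _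
  have hprod : Summable fun k : ℤ => 𝓕 f k * fourier k ((t / d : ℝ) : UnitAddCircle) := by
    have h1 : Summable fun k : ℤ =>
        (d / H : ℂ) * (𝓕 f k * fourier k ((t / d : ℝ) : UnitAddCircle)) := by
      simp_rw [hterm]
      exact hosum.add hconst.summable
    refine (summable_mul_left_iff ?_).1 h1
    exact div_ne_zero (by exact_mod_cast hd.ne') (by exact_mod_cast hH.ne')
  -- The characters are unimodular, so summability passes from the products to the coefficients.
  have hfsum : Summable fun k : ℤ => 𝓕 f k := by
    refine (summable_norm_iff.2 hprod).of_norm_bounded_eventually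
      (Eventually.of_forall fun k => ?_)
    rw [norm_mul, fourier_apply, Circle.norm_coe, mul_one]
  have hdecay : f =O[cocompact ℝ] fun x : ℝ => |x| ^ (-(2 : ℝ)) := by
    refine Asymptotics.IsBigO.of_bound (M * (2 / d ^ 2)) ?_
    have hne : ∀ᶠ x : ℝ in cocompact ℝ, x ≠ 0 :=
      isCompact_singleton.compl_mem_cocompact
    filter_upwards [hne] with x hx
    have hx' : 0 < |x| := abs_pos.2 hx
    rw [hf, Complex.norm_real, Real.norm_eq_abs, Real.norm_eq_abs,
      abs_of_nonneg (Real.rpow_nonneg (abs_nonneg x) _), Real.rpow_neg (abs_nonneg x),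
      Real.rpow_two]
    refine (hM _).trans ?_
    rw [mul_assoc]
    refine mul_le_mul_of_nonneg_left ?_ hM0
    rw [abs_mul, abs_of_pos hd, Real.exp_neg, ← one_div, ← one_div, div_mul_div_comm,
      div_le_div_iff₀ (Real.exp_pos _) (by positivity)]
    -- From `exp y ≥ y²/2` with `y = |x| d`, whence the constant `2 / d²`.
    have := Real.quadratic_le_exp_of_nonneg (mul_pos hx' hd).le
    nlinarith [mul_pos hx' hd]
  have hpoisson := Real.tsum_eq_tsum_fourier_of_rpow_decay_of_summable hfc one_lt_two hdecay
    hfsum (t / d)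
  have hlhs : ∑' j : ℤ, f (t / d + j) = ((∑' j : ℤ, centeredOccupancy p q (t + j * d) : ℝ) : ℂ) := by
    rw [Complex.ofReal_tsum]
    refine tsum_congr fun j => ?_
    simp only [hf]
    congr 2
    field_simp
  have htot : HasSum (fun k : ℤ => oscillationTerm H d k t +
      if k = 0 then ((entropySecondMoment p q / (2 * H ^ 2) : ℝ) : ℂ) else 0)
      ((d / H : ℂ) * ((∑' j : ℤ, centeredOccupancy p q (t + j * d) : ℝ) : ℂ)) := by
    rw [← hlhs, hpoisson]
    simp_rw [← hterm]
    exact hprod.hasSum.mul_left _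
  have hfinal := htot.sub hconst
  simp only [add_sub_cancel_right] at hfinal
  have hcast : ((d / H * ∑' j : ℤ, centeredOccupancy p q (t + j * d) -
      entropySecondMoment p q / (2 * H ^ 2) : ℝ) : ℂ) =
      (d / H : ℂ) * ((∑' j : ℤ, centeredOccupancy p q (t + j * d) : ℝ) : ℂ) -
        ((entropySecondMoment p q / (2 * H ^ 2) : ℝ) : ℂ) := by
    rw [Complex.ofReal_sub, Complex.ofReal_mul, Complex.ofReal_div]
  rw [hcast]
  exact hfinal

end Lattice

/-! ### Poisson approximation -/

/-- The Poisson approximation of `(1 - y) ^ N`. -/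
lemma abs_one_sub_pow_sub_exp_le (N : ℕ) {y : ℝ} (hy0 : 0 < y) (hy1 : y ≤ 1) :
    |(1 - y) ^ N - Real.exp (-((N + 1) * y))| ≤
      12 / (N + 1) * Real.exp (-|Real.log ((N + 1) * y)|) := by
  have hn : (0 : ℝ) < N + 1 := by positivity
  set n : ℝ := N + 1 with hndef
  have hz : 0 < n * y := mul_pos hn hy0
  set z := n * y with hzdef
  have hE := Real.exp_pos (-z)
  have hupper : (1 - y) ^ N - Real.exp (-z) ≤ 3 / n * (z * Real.exp (-z)) := by
    have h1 : (1 - y) ^ N ≤ Real.exp (-y) ^ N :=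
      pow_le_pow_left₀ (by linarith) (Real.one_sub_le_exp_neg y) N
    have h2 : Real.exp (-y) ^ N = Real.exp (-z) * Real.exp y := by
      rw [← Real.exp_nat_mul, ← Real.exp_add]
      congr 1
      rw [hzdef, hndef]
      ring
    have h3 : Real.exp y - 1 ≤ 3 * y := by
      have h4 := Real.one_sub_le_exp_neg y
      rw [Real.exp_neg] at h4
      have h5 : Real.exp y ≤ 3 := (Real.exp_le_exp.2 hy1).trans Real.exp_one_lt_three.le
      have h6 : (1 - y) * Real.exp y ≤ 1 := by
        rwa [← le_div_iff₀ (Real.exp_pos y), one_div]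
      nlinarith
    calc (1 - y) ^ N - Real.exp (-z) ≤ Real.exp (-z) * (Real.exp y - 1) := by
          rw [mul_sub, mul_one, ← h2]; linarith
      _ ≤ Real.exp (-z) * (3 * y) := mul_le_mul_of_nonneg_left h3 hE.le
      _ = 3 / n * (z * Real.exp (-z)) := by rw [hzdef]; field_simp
  -- Bernoulli's inequality applied to `1 - y² ≤ (1 - y) exp y`, raised to the power `N + 1`.
  have hlower : Real.exp (-z) - (1 - y) ^ N ≤ 1 / n * (z ^ 2 * Real.exp (-z)) := by
    have h1 : 1 - y ^ 2 ≤ (1 - y) * Real.exp y := by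
      have := mul_le_mul_of_nonneg_left (Real.add_one_le_exp y) (show 0 ≤ 1 - y by linarith)
      linarith
    have h2 : 1 - n * y ^ 2 ≤ (1 - y ^ 2) ^ (N + 1) := by
      have := one_add_mul_le_pow (a := -y ^ 2) (by nlinarith) (N + 1)
      push_cast at this
      rw [← hndef] at this
      rw [sub_eq_add_neg 1 (y ^ 2)]
      linarith
    have h3 : (1 - y ^ 2) ^ (N + 1) ≤ (1 - y) ^ (N + 1) * Real.exp z := by
      have h4 := pow_le_pow_left₀ (by nlinarith) h1 (N + 1)
      rw [mul_pow, ← Real.exp_nat_mul] at h4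
      push_cast at h4
      exact h4
    have h5 : (1 - y) ^ (N + 1) ≤ (1 - y) ^ N :=
      pow_le_pow_of_le_one (by linarith) (by linarith) (Nat.le_succ N)
    have h6 : (1 - n * y ^ 2) * Real.exp (-z) ≤ (1 - y) ^ N := by
      rw [Real.exp_neg, ← div_eq_mul_inv, div_le_iff₀ (Real.exp_pos z)]
      exact h2.trans (h3.trans (mul_le_mul_of_nonneg_right h5 (Real.exp_pos z).le))
    have h7 : 1 / n * (z ^ 2 * Real.exp (-z)) = n * y ^ 2 * Real.exp (-z) := by
      rw [hzdef]; field_simp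
    rw [h7]
    linarith
  -- With `t = log z` these bound `z exp(-z)` by `2 exp(-|log z|)` and `z² exp(-z)` by `6 exp(-|log
  -- z|)`. Each side of the estimate then costs at most `6/n`, so the constant `12` has slack.
  have hb0 := exp_pow_mul_exp_neg_exp_le 0 (Real.log z)
  have hb1 := exp_pow_mul_exp_neg_exp_le 1 (Real.log z)
  rw [Real.exp_log hz] at hb0 hb1
  have f2 : ((0 + 2).factorial : ℝ) = 2 := by norm_num [Nat.factorial]
  have f3 : ((1 + 2).factorial : ℝ) = 6 := by norm_num [Nat.factorial]
  rw [f2, zero_add, pow_one] at hb0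
  rw [f3, one_add_one_eq_two] at hb1
  have hinv : 0 < 1 / n := by positivity
  have e3 : 3 / n = 3 * (1 / n) := by ring
  have e12 : 12 / n = 12 * (1 / n) := by ring
  rw [e3] at hupper
  rw [e12]
  have hexp := Real.exp_pos (-|Real.log z|)
  have hm0 := mul_le_mul_of_nonneg_left hb0 hinv.le
  have hm1 := mul_le_mul_of_nonneg_left hb1 hinv.le
  have hpos := mul_pos hinv hexp
  rw [abs_le]
  constructor <;> nlinarith

/-! ### From sums over words to the potential of the occupancy -/

section Depth

variable {p q : ℝ}

/-- The potential of `occupancy`. -/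
def occupancyPotential (p q t : ℝ) : ℝ :=
  occupancyPrimitive t / walkMean p q + potential p q (centeredOccupancy p q) t

/-- The Poisson error at a word decays exponentially in `|t + log P(w)|`, so its sum over all words
is a potential bounded uniformly in `t`, times `12/(N + 1)`. The factor `c` enters only as the shift
`log c`: `c = 1` serves the trie, `c = p` and `c = q` the Patricia trie. -/
lemma exists_hasSum_words (hp : 0 < p) (hq : 0 < q) (hpq : p + q = 1) {c : ℝ} (hc0 : 0 < c)
    (hc1 : c ≤ 1) (N : ℕ) :
    ∃ S, HasSum (fun k => ∑ w : Fin k → Bool, wordProb p q w *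
        (1 - (1 - wordProb p q w * c) ^ N)) S ∧
      |S - occupancyPotential p q (Real.log ((N + 1 : ℕ) : ℝ) + Real.log c)| ≤
        24 / (p * q) / (N + 1 : ℕ) := by
  have hn : (0 : ℝ) < (N + 1 : ℕ) := by positivity
  set t := Real.log ((N + 1 : ℕ) : ℝ) + Real.log c with ht
  set E : ℕ → ℝ := fun k => ∑ w : Fin k → Bool, wordProb p q w *
    (Real.exp (-Real.exp (t + Real.log (wordProb p q w))) - (1 - wordProb p q w * c) ^ N) with hE
  have hEle : ∀ k, |E k| ≤ 12 / (N + 1) * (avg p q)^[k] (fun s => Real.exp (-|s|)) t := by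
    intro k
    rw [iterate_avg_eq_sum hp hq, Finset.mul_sum]
    refine (Finset.abs_sum_le_sum_abs _ _).trans (Finset.sum_le_sum fun w _ => ?_)
    have hw := wordProb_pos hp hq w
    have hy0 : 0 < wordProb p q w * c := mul_pos hw hc0
    have hy1 : wordProb p q w * c ≤ 1 :=
      mul_le_one₀ (wordProb_le_one hp hq hpq w) hc0.le hc1
    have hlog : t + Real.log (wordProb p q w) = Real.log ((N + 1) * (wordProb p q w * c)) := by
      rw [Real.log_mul (by positivity) hy0.ne', Real.log_mul hw.ne' hc0.ne', ht]
      push_cast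
      ring
    have := abs_one_sub_pow_sub_exp_le N hy0 hy1
    rw [abs_mul, abs_of_pos hw, abs_sub_comm, hlog, Real.exp_log (by positivity)]
    calc _ ≤ wordProb p q w * _ := mul_le_mul_of_nonneg_left this hw.le
      _ = _ := by ring
  have hbound : ∀ m, ∑ k ∈ Finset.range m, |E k| ≤ 24 / (p * q) / (N + 1 : ℕ) := by
    intro m
    have h1 := sum_iterate_avg_exp_neg_abs_le hp hq hpq m t
    have h2 : 2 / (p * q) * logistic t ≤ 2 / (p * q) * 1 :=
      mul_le_mul_of_nonneg_left (logistic_le_one t) (by positivity)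
    calc _ ≤ ∑ k ∈ Finset.range m,
          12 / (N + 1) * (avg p q)^[k] (fun s => Real.exp (-|s|)) t :=
          Finset.sum_le_sum fun k _ => hEle k
      _ ≤ 12 / (N + 1) * (2 / (p * q) * 1) := by
          rw [← Finset.mul_sum]
          exact mul_le_mul_of_nonneg_left (h1.trans h2) (by positivity)
      _ = _ := by push_cast; ring
  have hsumm : Summable E := (summable_of_sum_range_le (fun _ => abs_nonneg _) hbound).of_abs
  have htot := (hasSum_iterate_avg_occupancy hp hq hpq t).add hsumm.hasSum
  refine ⟨occupancyPotential p q t + ∑' k, E k, ?_, ?_⟩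
  · have heq : ∀ k, ∑ w : Fin k → Bool, wordProb p q w * (1 - (1 - wordProb p q w * c) ^ N) =
        (avg p q)^[k] occupancy t + E k := by
      intro k
      rw [iterate_avg_eq_sum hp hq, hE, ← Finset.sum_add_distrib]
      refine Finset.sum_congr rfl fun w _ => ?_
      rw [occupancy]
      ring
    simp_rw [heq]
    exact htot
  · rw [add_sub_cancel_left]
    refine le_of_tendsto hsumm.hasSum.tendsto_sum_nat.abs (Eventually.of_forall fun m => ?_)
    exact (Finset.abs_sum_le_sum_abs _ _).trans (hbound m)

lemma closure_log_le_asymptoticPeriods_potential (hp : 0 < p) (hq : 0 < q) (hpq : p + q = 1) :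
    AddSubgroup.closure {Real.log p, Real.log q} ≤
      asymptoticPeriods (potential p q (centeredOccupancy p q)) := by
  obtain ⟨M, hM⟩ := abs_centeredOccupancy_le hp hq hpq
  have hM0 : 0 ≤ M := by
    have := (abs_nonneg _).trans (hM 0)
    simpa using this
  refine closure_le_asymptoticPeriods hp hq hpq (B := M * (2 / (p * q))) (fun t => ?_)
    (tendsto_atTop_zero_of_abs_le_exp hM) (potential_eq hp hq hpq hM)
  refine (abs_potential_le hp hq hpq hM t).trans ?_
  exact mul_le_of_le_one_right (by positivity) (logistic_le_one t)

/-- The reason why the saving does not oscillate: the bounded part of the potential does not notice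
the shift asymptotically, and the primitive is `t + γ + o(1)`. -/
lemma tendsto_occupancyPotential_shift_sub (hp : 0 < p) (hq : 0 < q) (hpq : p + q = 1) {u : ℝ}
    (hu : u ∈ AddSubgroup.closure {Real.log p, Real.log q}) :
    Tendsto (fun t => occupancyPotential p q (t + u) - occupancyPotential p q t) atTop
      (𝓝 (u / walkMean p q)) := by
  have h1 := mem_asymptoticPeriods.1 (closure_log_le_asymptoticPeriods_potential hp hq hpq hu)
  have h2 := tendsto_occupancyPrimitive_sub
  have h3 := h2.comp (tendsto_atTop_add_const_right atTop u tendsto_id)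
  have h4 := (((h3.sub h2).div_const (walkMean p q)).sub h1).add_const (u / walkMean p q)
  simp only [sub_zero, zero_div, zero_add] at h4
  refine h4.congr fun t => ?_
  simp only [occupancyPotential, Function.comp, id]
  ring

lemma tendsto_occupancyPotential_sub_potential (p q : ℝ) :
    Tendsto (fun t => occupancyPotential p q t - ((t + Real.eulerMascheroniConstant) /
      walkMean p q + potential p q (centeredOccupancy p q) t)) atTop (𝓝 0) := by
  have h := tendsto_occupancyPrimitive_sub.div_const (walkMean p q)
  rw [zero_div] at h
  refine h.congr fun t => ?_
  rw [occupancyPotential]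
  ring

lemma tendsto_potential_of_irrational (hp : 0 < p) (hq : 0 < q) (hpq : p + q = 1)
    (hirr : Irrational (Real.log p / Real.log q)) :
    Tendsto (potential p q (centeredOccupancy p q)) atTop
      (𝓝 (entropySecondMoment p q / (2 * walkMean p q ^ 2))) := by
  obtain ⟨M, hM⟩ := abs_centeredOccupancy_le hp hq hpq
  have hM0 : 0 ≤ M := by
    have := (abs_nonneg _).trans (hM 0)
    simpa using this
  have hH := walkMean_pos hp hq hpq
  have hunif := uniformContinuous_potential hp hq hpq hM hasDerivAt_centeredOccupancy
    (abs_centeredOccupancyDeriv_le hp hq hpq)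
  have hdense := (dense_addSubgroupClosure_pair_iff.2 hirr).mono
    (closure_log_le_asymptoticPeriods_potential hp hq hpq)
  have hlim := tendsto_of_asymptoticPeriods_eq_top (u := Real.log p) (v := Real.log q)
    (B := M * (2 / (p * q))) (C := M * (2 / (p * q))) hpq hunif.continuous
    (fun t => (abs_potential_le hp hq hpq hM t).trans
      (mul_le_of_le_one_right (by positivity) (logistic_le_one t)))
    (fun t => (abs_potential_le hp hq hpq hM t).trans
      (mul_le_mul_of_nonneg_left (logistic_le_exp t) (by positivity)))
    (integrable_centeredOccupancy hp hq hpq) (potential_eq hp hq hpq hM)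
    (asymptoticPeriods_eq_top hunif hdense) hH
  convert hlim using 2
  rw [integral_centeredOccupancy hp hq hpq, ← walkMean]
  field_simp

/-- A subgroup of the reals that is not dense is cyclic, and the modulus of a generator is the
greatest common divisor, since any common divisor divides every element of the group. Membership in
the group also makes `d` an asymptotic period. -/
lemma exists_isGreatest_commonDivisors (hp : 0 < p) (hq : 0 < q) (hpq : p + q = 1)
    (hrat : ¬ Irrational (Real.log p / Real.log q)) :
    ∃ d, IsGreatest (commonDivisors (Real.log p) (Real.log q)) d ∧
      d ∈ AddSubgroup.closure {Real.log p, Real.log q} := by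
  rw [← dense_addSubgroupClosure_pair_iff] at hrat
  obtain ⟨a, ha⟩ := (AddSubgroup.dense_or_cyclic _).resolve_left hrat
  have hp_mem : Real.log p ∈ AddSubgroup.closure {a} :=
    ha ▸ AddSubgroup.subset_closure (Set.mem_insert _ _)
  have hq_mem : Real.log q ∈ AddSubgroup.closure {a} :=
    ha ▸ AddSubgroup.subset_closure (Set.mem_insert_of_mem _ rfl)
  have ha0 : a ≠ 0 := by
    rintro rfl
    obtain ⟨m, hm⟩ := AddSubgroup.mem_closure_singleton.1 hp_mem
    rw [smul_zero] at hm
    exact (log_neg_left hp hq hpq).ne hm.symm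
  have hdiv : ∀ x ∈ AddSubgroup.closure {a}, ∃ m : ℤ, x = m * |a| := by
    intro x hx
    obtain ⟨m, rfl⟩ := AddSubgroup.mem_closure_singleton.1 hx
    rw [zsmul_eq_mul]
    rcases abs_choice a with h | h
    · exact ⟨m, by rw [h]⟩
    · exact ⟨-m, by rw [h]; push_cast; ring⟩
  have hmem : |a| ∈ AddSubgroup.closure {Real.log p, Real.log q} := by
    rw [ha]
    have := AddSubgroup.subset_closure (Set.mem_singleton a)
    rcases abs_choice a with h | h <;> rw [h]
    · exact this
    · exact neg_mem this
  refine ⟨|a|, ⟨⟨abs_pos.2 ha0, hdiv _ hp_mem, hdiv _ hq_mem⟩, ?_⟩, hmem⟩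
  rintro d ⟨hd, ⟨m, hm⟩, n, hn⟩
  have hle : AddSubgroup.closure {Real.log p, Real.log q} ≤ AddSubgroup.zmultiples d := by
    rw [AddSubgroup.closure_le]
    rintro x (rfl | rfl)
    · exact ⟨m, by simp [hm]⟩
    · exact ⟨n, by simp [hn]⟩
  obtain ⟨k, hk⟩ := AddSubgroup.mem_zmultiples_iff.1 (hle hmem)
  rw [zsmul_eq_mul] at hk
  have hkpos : (0 : ℝ) < k := by
    by_contra! hneg
    have := mul_nonpos_of_nonpos_of_nonneg hneg hd.le
    rw [hk] at this
    exact absurd (abs_pos.2 ha0) (not_lt.2 this)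
  have hk0 : 0 < k := by exact_mod_cast hkpos
  have hk1 : (1 : ℝ) ≤ k := by exact_mod_cast (by omega : 1 ≤ k)
  rw [← hk]
  nlinarith

lemma exists_nat_of_log {x d : ℝ} (hx : x < 0) (hd : 0 < d) {m : ℤ} (hm : x = m * d) :
    ∃ k : ℕ, x = -(k * d) := by
  have hneg : m ≤ 0 := by
    by_contra! hpos
    have : (0 : ℝ) < m := by exact_mod_cast hpos
    nlinarith [mul_pos this hd]
  refine ⟨(-m).toNat, ?_⟩
  have : (((-m).toNat : ℤ) : ℝ) = ((-m : ℤ) : ℝ) := by rw [Int.toNat_of_nonneg (by omega)]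
  rw [Int.cast_natCast] at this
  rw [this, hm]
  push_cast
  ring

lemma tendsto_potential_sub_lattice_sum (hp : 0 < p) (hq : 0 < q) (hpq : p + q = 1) {d : ℝ}
    (hd : 0 < d) {m n : ℤ} (hm : Real.log p = m * d) (hn : Real.log q = n * d)
    (hmem : d ∈ AddSubgroup.closure {Real.log p, Real.log q}) :
    Tendsto (fun t => potential p q (centeredOccupancy p q) t -
      d / walkMean p q * ∑' j : ℤ, centeredOccupancy p q (t + j * d)) atTop (𝓝 0) := by
  obtain ⟨M, hM⟩ := abs_centeredOccupancy_le hp hq hpq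
  have hM0 : 0 ≤ M := by
    have := (abs_nonneg _).trans (hM 0)
    simpa using this
  obtain ⟨m', hm'⟩ := exists_nat_of_log (log_neg_left hp hq hpq) hd hm
  obtain ⟨n', hn'⟩ := exists_nat_of_log (log_neg_right hp hq hpq) hd hn
  have hH : walkMean p q = (p * m' + q * n') * d := by
    rw [walkMean, hm', hn']
    ring
  rw [hH]
  refine tendsto_sub_lattice_sum (C := M * (2 / (p * q))) hd hpq
    (fun t => (abs_potential_le hp hq hpq hM t).trans
      (mul_le_mul_of_nonneg_left (logistic_le_exp t) (by positivity))) hM (fun t => ?_)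
    (closure_log_le_asymptoticPeriods_potential hp hq hpq hmem) (hH ▸ walkMean_pos hp hq hpq)
  rw [potential_eq hp hq hpq hM t, hm', hn', sub_eq_add_neg, sub_eq_add_neg]

end Depth

/-! ### Asymptotics of the expected depths -/

section Asymptotics

variable {Ω : Type*} [MeasurableSpace Ω] {μ : Measure Ω} {p q : ℝ}
  {ξ : ℕ → ℕ → Ω → Bool}

lemma tendsto_const_div_succ (C : ℝ) :
    Tendsto (fun N : ℕ => C / ((N + 1 : ℕ) : ℝ)) atTop (𝓝 0) :=
  (tendsto_const_div_atTop_nhds_zero_nat C).comp (tendsto_add_atTop_nat 1)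

lemma tendsto_log_natCast : Tendsto (fun n : ℕ => Real.log n) atTop atTop :=
  Real.tendsto_log_atTop.comp tendsto_natCast_atTop_atTop

lemma IsRandomStrings.le_one_left (h : IsRandomStrings μ p q ξ) : p ≤ 1 := by
  linarith [h.pos_right, h.add_eq_one]

lemma IsRandomStrings.le_one_right (h : IsRandomStrings μ p q ξ) : q ≤ 1 := by
  linarith [h.pos_left, h.add_eq_one]

theorem IsRandomStrings.trieDepth_asymptotic [IsProbabilityMeasure μ]
    (h : IsRandomStrings μ p q ξ) :
    (∀ n, Integrable (fun ω => (trieDepth (fun j i => ξ j i ω) n : ℝ)) μ) ∧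
      Tendsto (fun n : ℕ => (∫ ω, (trieDepth (fun j i => ξ j i ω) n : ℝ) ∂μ) -
        occupancyPotential p q (Real.log n)) atTop (𝓝 0) := by
  choose S hS hSle using exists_hasSum_words h.pos_left h.pos_right h.add_eq_one one_pos le_rfl
  have hint : ∀ N, _ := fun N => h.integral_trieDepth N (S := S N) (by simpa using hS N)
  refine ⟨fun n => ?_, (tendsto_add_atTop_iff_nat 1).1 ?_⟩
  · rcases n with _ | N
    · simp [trieDepth_zero]
    · exact (hint N).1
  · refine squeeze_zero_norm (fun N => ?_) (tendsto_const_div_succ (24 / (p * q)))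
    rw [(hint N).2, Real.norm_eq_abs]
    simpa only [Real.log_one, add_zero] using hSle N

/-- The level probabilities split linearly into the sums with `c = q`, weighted by `p`, and with `c
= p`, weighted by `q`: the letter of the first string and the opposite letter of the string
branching off. Both shifts are asymptotic periods, which yields the constant correction. -/
theorem IsRandomStrings.patriciaDepth_asymptotic [IsProbabilityMeasure μ]
    (h : IsRandomStrings μ p q ξ) :
    (∀ n, Integrable (fun ω => (patriciaDepth (fun j i => ξ j i ω) n : ℝ)) μ) ∧
      Tendsto (fun n : ℕ => (∫ ω, (patriciaDepth (fun j i => ξ j i ω) n : ℝ) ∂μ) -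
        (occupancyPotential p q (Real.log n) +
          (p * Real.log q + q * Real.log p) / walkMean p q)) atTop (𝓝 0) := by
  choose S hS hSle using exists_hasSum_words h.pos_left h.pos_right h.add_eq_one h.pos_left
    h.le_one_left
  choose R hR hRle using exists_hasSum_words h.pos_left h.pos_right h.add_eq_one h.pos_right
    h.le_one_right
  have hsum : ∀ N, HasSum (fun k => ∑ w : Fin k → Bool, wordProb p q w *
      (1 - p * (1 - wordProb p q w * q) ^ N - q * (1 - wordProb p q w * p) ^ N))
      (p * R N + q * S N) := by
    intro N
    have heq : ∀ k, ∑ w : Fin k → Bool, wordProb p q w *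
        (1 - p * (1 - wordProb p q w * q) ^ N - q * (1 - wordProb p q w * p) ^ N) =
        p * (∑ w : Fin k → Bool, wordProb p q w * (1 - (1 - wordProb p q w * q) ^ N)) +
        q * ∑ w : Fin k → Bool, wordProb p q w * (1 - (1 - wordProb p q w * p) ^ N) := by
      intro k
      rw [Finset.mul_sum, Finset.mul_sum, ← Finset.sum_add_distrib]
      refine Finset.sum_congr rfl fun w _ => ?_
      linear_combination (-wordProb p q w) * h.add_eq_one
    simp_rw [heq]
    exact ((hR N).mul_left p).add ((hS N).mul_left q)
  have hint : ∀ N, _ := fun N => h.integral_patriciaDepth N (hsum N)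
  refine ⟨fun n => ?_, (tendsto_add_atTop_iff_nat 1).1 ?_⟩
  · rcases n with _ | N
    · simp [patriciaDepth_zero]
    · exact (hint N).1
  · have hlog : Tendsto (fun N : ℕ => Real.log ((N + 1 : ℕ) : ℝ)) atTop atTop :=
      tendsto_log_natCast.comp (tendsto_add_atTop_nat 1)
    have hp := (tendsto_occupancyPotential_shift_sub h.pos_left h.pos_right h.add_eq_one
      (AddSubgroup.subset_closure (Set.mem_insert (Real.log p) {Real.log q}))).comp hlog
    have hq := (tendsto_occupancyPotential_shift_sub h.pos_left h.pos_right h.add_eq_one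
      (AddSubgroup.subset_closure (Set.mem_insert_of_mem (Real.log p) rfl) :
        Real.log q ∈ AddSubgroup.closure {Real.log p, Real.log q})).comp hlog
    have hSlim : Tendsto (fun N => S N -
        occupancyPotential p q (Real.log ((N + 1 : ℕ) : ℝ) + Real.log p)) atTop (𝓝 0) :=
      squeeze_zero_norm hSle (tendsto_const_div_succ _)
    have hRlim : Tendsto (fun N => R N -
        occupancyPotential p q (Real.log ((N + 1 : ℕ) : ℝ) + Real.log q)) atTop (𝓝 0) :=
      squeeze_zero_norm hRle (tendsto_const_div_succ _)
    have hall := (((hRlim.add hq).const_mul p).add ((hSlim.add hp).const_mul q)).sub_const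
      ((p * Real.log q + q * Real.log p) / walkMean p q)
    have hz : p * (0 + Real.log q / walkMean p q) + q * (0 + Real.log p / walkMean p q) -
        (p * Real.log q + q * Real.log p) / walkMean p q = 0 := by ring
    rw [hz] at hall
    refine hall.congr fun N => ?_
    rw [(hint N).2]
    simp only [Function.comp]
    linear_combination
      (-occupancyPotential p q (Real.log ((N + 1 : ℕ) : ℝ))) * h.add_eq_one

lemma walkMean_eq_binEntropy (hpq : p + q = 1) : walkMean p q = Real.binEntropy p := by
  rw [walkMean, Real.binEntropy, Real.log_inv, Real.log_inv, ← hpq, add_sub_cancel_left]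
  ring

/-- The oscillation of the expected depth. -/
def oscillation (p q d t : ℝ) : ℝ :=
  d / walkMean p q * ∑' j : ℤ, centeredOccupancy p q (t + j * d) -
    entropySecondMoment p q / (2 * walkMean p q ^ 2)

lemma periodic_oscillation (p q d : ℝ) : Function.Periodic (oscillation p q d) d := by
  intro t
  rw [oscillation, oscillation, ← (Equiv.addRight (1 : ℤ)).tsum_eq
    fun j : ℤ => centeredOccupancy p q (t + j * d)]
  congr 2
  refine tsum_congr fun j => ?_
  congr 1
  simp only [Equiv.coe_addRight]
  push_cast
  ring

lemma continuous_oscillation (hp : 0 < p) (hq : 0 < q) (hpq : p + q = 1) {d : ℝ} (hd : 0 < d)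
    {m n : ℤ} (hm : Real.log p = m * d) (hn : Real.log q = n * d) :
    Continuous (oscillation p q d) := by
  have h : oscillation p q d =
      fun t => (∑' k : ℤ, oscillationTerm (walkMean p q) d k t).re := by
    ext t
    rw [(hasSum_oscillationTerm hp hq hpq hd hm hn t).tsum_eq, Complex.ofReal_re, oscillation]
  rw [h]
  exact Complex.continuous_re.comp (continuous_tsum (continuous_oscillationTerm _ d)
    ((Real.summable_one_div_int_pow.2 one_lt_two).mul_left _)
    fun k t => norm_oscillationTerm_le (walkMean_pos hp hq hpq) hd k t)

/-- The index `0` can be dropped because its term is `0` by the convention for `Complex.Gamma 0`.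
Since `HasSum` over the integers is unconditional, convergence in the complex numbers is absolute.
-/
lemma hasSum_oscillationTerm_ne_zero (hp : 0 < p) (hq : 0 < q) (hpq : p + q = 1) {d : ℝ}
    (hd : 0 < d) {m n : ℤ} (hm : Real.log p = m * d) (hn : Real.log q = n * d) (t : ℝ) :
    HasSum (fun k : {k : ℤ // k ≠ 0} => oscillationTerm (walkMean p q) d k t)
      (oscillation p q d t : ℂ) := by
  have h := hasSum_oscillationTerm hp hq hpq hd hm hn t
  refine (hasSum_subtype_iff_of_support_subset (s := {k : ℤ | k ≠ 0}) ?_).2 h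
  intro k hk h0
  refine hk ?_
  simp [oscillationTerm, h0]

end Asymptotics

end RandomTrie

end

/-! ### The theorem -/

theorem mainTheorem10
    {Ω : Type*} [MeasurableSpace Ω] (μ : Measure Ω) [IsProbabilityMeasure μ]
    (p q : ℝ) (hp0 : 0 < p) (hp1 : p < 1) (hq : q = 1 - p)
    (ξ : ℕ → ℕ → Ω → Bool)
    (hmeas : ∀ j i, Measurable (ξ j i))
    (hindep : iIndepFun (fun ji : ℕ × ℕ => ξ ji.1 ji.2) μ)
    (hlaw : ∀ j i, μ {ω | ξ j i ω = true} = ENNReal.ofReal p)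
    (H H₂ : ℝ) (hH : H = Real.binEntropy p)
    (hH₂ : H₂ = RandomTrie.entropySecondMoment p q)
    (D DP : ℕ → Ω → ℝ)
    (hD : ∀ n ω, D n ω = (RandomTrie.trieDepth (fun j i => ξ j i ω) n : ℝ))
    (hDP : ∀ n ω, DP n ω = (RandomTrie.patriciaDepth (fun j i => ξ j i ω) n : ℝ)) :
    (∀ n, Integrable (D n) μ ∧ Integrable (DP n) μ) ∧
    (Irrational (Real.log p / Real.log q) →
      Tendsto (fun n : ℕ => (∫ ω, DP n ω ∂μ) -
          (Real.log n / H + H₂ / (2 * H ^ 2) +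
            (Real.eulerMascheroniConstant + q * Real.log p + p * Real.log q) / H))
        atTop (𝓝 0)) ∧
    (¬ Irrational (Real.log p / Real.log q) →
      ∃ (d : ℝ) (ψ : ℝ → ℝ),
        IsGreatest (RandomTrie.commonDivisors (Real.log p) (Real.log q)) d ∧
        Continuous ψ ∧ Function.Periodic ψ d ∧
        (∀ t : ℝ, HasSum
          (fun k : {k : ℤ // k ≠ 0} =>
            -(1 / (H : ℂ)) * (Complex.Gamma (-2 * Real.pi * Complex.I * (k : ℤ) / d) *
              Complex.exp (2 * Real.pi * Complex.I * (k : ℤ) * t / d)))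
          (ψ t : ℂ)) ∧
        Tendsto (fun n : ℕ => (∫ ω, D n ω ∂μ) -
            (Real.log n / H + H₂ / (2 * H ^ 2) + Real.eulerMascheroniConstant / H +
              ψ (Real.log n)))
          atTop (𝓝 0) ∧
        Tendsto (fun n : ℕ => (∫ ω, DP n ω ∂μ) -
            (Real.log n / H + H₂ / (2 * H ^ 2) +
              (Real.eulerMascheroniConstant + q * Real.log p + p * Real.log q) / H +
              ψ (Real.log n)))
          atTop (𝓝 0)) ∧
    Tendsto (fun n : ℕ => ∫ ω, (D n ω - DP n ω) ∂μ) atTop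
      (𝓝 ((-q * Real.log p - p * Real.log q) / H)) := by
  have hq0 : 0 < q := by linarith
  have hpq : p + q = 1 := by linarith
  have h : RandomTrie.IsRandomStrings μ p q ξ := ⟨hp0, hq0, hpq, hmeas, hindep, hlaw⟩
  obtain rfl : D = fun n ω => (RandomTrie.trieDepth (fun j i => ξ j i ω) n : ℝ) :=
    funext fun n => funext fun ω => hD n ω
  obtain rfl : DP = fun n ω => (RandomTrie.patriciaDepth (fun j i => ξ j i ω) n : ℝ) :=
    funext fun n => funext fun ω => hDP n ω
  rw [← RandomTrie.walkMean_eq_binEntropy hpq] at hH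
  subst hH hH₂
  obtain ⟨hDi, hDlim⟩ := h.trieDepth_asymptotic
  obtain ⟨hPi, hPlim⟩ := h.patriciaDepth_asymptotic
  have hlog := RandomTrie.tendsto_log_natCast
  have hpot := (RandomTrie.tendsto_occupancyPotential_sub_potential p q).comp hlog
  refine ⟨fun n => ⟨hDi n, hPi n⟩, fun hirr => ?_, fun hrat => ?_, ?_⟩
  · have hV := ((RandomTrie.tendsto_potential_of_irrational hp0 hq0 hpq hirr).comp hlog).sub_const
      (RandomTrie.entropySecondMoment p q / (2 * RandomTrie.walkMean p q ^ 2))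
    rw [sub_self] at hV
    have hall := (hPlim.add hpot).add hV
    simp only [add_zero] at hall
    refine hall.congr fun n => ?_
    simp only [Function.comp]
    ring
  · obtain ⟨d, hgr, hmem⟩ :=
      RandomTrie.exists_isGreatest_commonDivisors hp0 hq0 hpq hrat
    obtain ⟨hd, ⟨m, hm⟩, n, hn⟩ := hgr.1
    have hV := (RandomTrie.tendsto_potential_sub_lattice_sum hp0 hq0 hpq hd hm hn hmem).comp hlog
    refine ⟨d, RandomTrie.oscillation p q d, hgr,
      RandomTrie.continuous_oscillation hp0 hq0 hpq hd hm hn,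
      RandomTrie.periodic_oscillation p q d,
      RandomTrie.hasSum_oscillationTerm_ne_zero hp0 hq0 hpq hd hm hn, ?_, ?_⟩
    · have hall := (hDlim.add hpot).add hV
      simp only [add_zero] at hall
      refine hall.congr fun n => ?_
      simp only [Function.comp, RandomTrie.oscillation]
      ring
    · have hall := (hPlim.add hpot).add hV
      simp only [add_zero] at hall
      refine hall.congr fun n => ?_
      simp only [Function.comp, RandomTrie.oscillation]
      ring
  -- Both depths are compared with the same potential at `log n`, which cancels, so no distinction
  -- between rational and irrational ratios is needed.
  · have hall := (hDlim.sub hPlim).add_const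
      ((-q * Real.log p - p * Real.log q) / RandomTrie.walkMean p q)
    simp only [sub_zero, zero_add] at hall
    refine hall.congr fun n => ?_
    rw [integral_sub (hDi n) (hPi n)]
    ring
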